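/- Let $k$ be an algebraically closed field of arbitrary characteristic. A curve over $k$ is a projective, reduced $k$-scheme of pure dimension $1$ (possibly reducible or disconnected); it is Gorenstein if all its local rings are Gorenstein. A morphism of curves is birational if it restricts to an isomorphism over a dense open subset of the target whose preimage is dense in the source. A coherent sheaf on a curve $C$ is torsion-free, rank-$1$ if all its associated points are generic points of $C$ and it is invertible on a dense open subset of $C$. Let $C$ be a Gorenstein curve over $k$, let $C^\dagger$ be a curve over $k$ and let $b\colon C^\dagger\to C$ be a birational $k$-morphism. Let $\mathcal F\subseteq\mathcal O_C$ be the conductor ideal of $b$, that is, the annihilator of the cokernel of the comorphism $b^\#\colon\mathcal O_C\to b_*\mathcal O_{C^\dagger}$. For a coherent sheaf $\mathcal J$ on $C$, let $\mathcal J^b$ denote the quotient of $b^*\mathcal J$ by its torsion subsheaf (the largest coherent subsheaf with finite support). Let $\mathcal I$ be a torsion-free, rank-$1$ sheaf on $C$ such that the sheaf $Hom(\mathcal I,\mathcal O_C)^b$ on $C^\dagger$ is invertible. Then there are an invertible sheaf $\mathcal L$ on $C$ and an injection $\varphi\colon\mathcal I\hookrightarrow\mathcal L$ of $\mathcal O_C$-modules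 such that $\varphi(\mathcal I)\supseteq\mathcal F\mathcal L$. -/

import Mathlib

open CategoryTheory AlgebraicGeometry TopologicalSpace Opposite

universe u

namespace CurveSheaf

noncomputable section

attribute [local instance] MvPolynomial.gradedAlgebra

/-! ### Curves -/

/-- Projective `n`-space over `k`, as `Proj k[x₀, …, xₙ]`. -/
def projSpace (k : Type u) [Field k] (n : ℕ) : Scheme.{u} :=
  Proj (MvPolynomial.homogeneousSubmodule (Fin (n + 1)) k)

/-- The structure morphism of projective space. -/
def projSpaceStr (k : Type u) [Field k] (n : ℕ) : projSpace k n ⟶ Spec (.of k) :=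
  Proj.toSpecZero (MvPolynomial.homogeneousSubmodule (Fin (n + 1)) k) ≫
    Spec.map (CommRingCat.ofHom
      (algebraMap k (MvPolynomial.homogeneousSubmodule (Fin (n + 1)) k 0)))

/-- A `k`-scheme is projective if it is a closed subscheme of some projective space over `k`. -/
def IsProjective {k : Type u} [Field k] {X : Scheme.{u}} (p : X ⟶ Spec (.of k)) : Prop :=
  ∃ (n : ℕ) (i : X ⟶ projSpace k n), IsClosedImmersion i ∧ i ≫ projSpaceStr k n = p

/-- A curve over `k`: a projective, reduced `k`-scheme of pure dimension 1
(it may be reducible or disconnected). -/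
structure IsCurve {k : Type u} [Field k] {X : Scheme.{u}} (p : X ⟶ Spec (.of k)) : Prop where
  projective : IsProjective p
  reduced : IsReduced X
  pure_dim : ∀ Z ∈ irreducibleComponents X, topologicalKrullDim Z = 1

/-- A (noetherian local) ring is Gorenstein if it has finite injective dimension over itself. -/
def IsGorensteinRing (R : Type u) [CommRing R] : Prop :=
  ∃ n : ℕ, HasInjectiveDimensionLE (ModuleCat.of R R) n

/-- All local rings are Gorenstein. -/
def IsGorenstein (X : Scheme.{u}) : Prop :=
  ∀ x : X, IsGorensteinRing (X.presheaf.stalk x)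

/-- A morphism is birational if it restricts to an isomorphism over a dense open subset of the
target whose preimage is dense in the source. -/
def IsBirational {X Y : Scheme.{u}} (f : X ⟶ Y) : Prop :=
  ∃ U : Y.Opens, Dense (U : Set Y) ∧ Dense ((f ⁻¹ᵁ U : X.Opens) : Set X) ∧ IsIso (f ∣_ U)

/-! ### Sheaves of modules -/

variable {X Y : Scheme.{u}}

/-- The structure sheaf `𝒪_X` as a module over itself. -/
def structureSheaf (X : Scheme.{u}) : X.Modules := SheafOfModules.unit X.ringCatSheaf

/-- Coherent sheaves (on a locally noetherian scheme): quasi-coherent, with finitely generated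
modules of sections over affine opens. -/
def IsCoherent (M : X.Modules) : Prop :=
  M.IsQuasicoherent ∧ ∀ U : X.Opens, IsAffineOpen U → Module.Finite Γ(X, U) Γ(M, U)

/-- Invertible sheaves: locally isomorphic to the structure sheaf. -/
def IsInvertible (M : X.Modules) : Prop :=
  ∀ x : X, ∃ U : X.Opens, x ∈ U ∧ Nonempty (M.restrict U.ι ≅ structureSheaf (U : Scheme.{u}))

/-- The `𝒪_{X,x}`-module structure of the stalk `M_x`. -/
instance stalkModule (M : X.Modules) (x : X) :
    Module (X.presheaf.stalk x) (M.presheaf.stalk x) :=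
  PresheafOfModules.instModuleCarrierStalkCommRingCatCarrierAbPresheafOpensCarrier
    (R := X.presheaf) M.val x

theorem germ_smul (M : X.Modules) (x : X) (U : X.Opens) (hx : x ∈ U) (a : Γ(X, U)) (s : Γ(M, U)) :
    M.presheaf.germ U x hx (a • s) = X.presheaf.germ U x hx a • M.presheaf.germ U x hx s :=
  PresheafOfModules.germ_smul (R := X.presheaf) M.val x U hx a s

/-- `x` is an associated point of `M` if the maximal ideal of `𝒪_{X,x}` is the annihilator of an
element of `M_x`. -/
def IsAssociatedPoint (M : X.Modules) (x : X) : Prop :=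
  ∃ s : M.presheaf.stalk x, ∀ a : X.presheaf.stalk x,
    a ∈ IsLocalRing.maximalIdeal (X.presheaf.stalk x) ↔ a • s = 0

/-- Torsion-free, rank-1 sheaves: coherent sheaves whose only associated points are generic points
of `X` and which are invertible on a dense open subset. -/
structure IsTorsionFreeRankOne (M : X.Modules) : Prop where
  coherent : IsCoherent M
  torsionFree : ∀ x : X, IsAssociatedPoint M x → x ∈ genericPoints X
  rankOne : ∃ U : X.Opens, Dense (U : Set X) ∧ IsInvertible (M.restrict U.ι)

/-! ### The sheaf `Hom(M, N)` -/

/-- The restriction map `Γ(M, U) → Γ(M, V)` for `V ≤ U`. -/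
abbrev res (M : X.Modules) {U V : X.Opens} (h : V ≤ U) (s : Γ(M, U)) : Γ(M, V) :=
  M.presheaf.map (homOfLE h).op s

/-- The restriction map `Γ(X, U) → Γ(X, V)` for `V ≤ U`. -/
abbrev resO {U V : X.Opens} (h : V ≤ U) (a : Γ(X, U)) : Γ(X, V) :=
  X.presheaf.map (homOfLE h).op a

theorem res_res (M : X.Modules) {U V W : X.Opens} (h : V ≤ U) (h' : W ≤ V) (s : Γ(M, U)) :
    res M h' (res M h s) = res M (h'.trans h) s := by
  simp only [res, ← ConcreteCategory.comp_apply, ← Functor.map_comp]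
  rfl

theorem resO_resO {U V W : X.Opens} (h : V ≤ U) (h' : W ≤ V) (a : Γ(X, U)) :
    resO h' (resO h a) = resO (h'.trans h) a := by
  simp only [resO, ← ConcreteCategory.comp_apply, ← Functor.map_comp]
  rfl

theorem resO_self {U : X.Opens} (h : U ≤ U) (a : Γ(X, U)) : resO h a = a := by
  simp [resO]

theorem res_smul (M : X.Modules) {U V : X.Opens} (h : V ≤ U) (a : Γ(X, U)) (s : Γ(M, U)) :
    res M h (a • s) = resO h a • res M h s :=
  M.map_smul _ _ _

/-- The sections of `Hom(M, N)` over `U`, that is, the `𝒪_U`-linear morphisms `M|_U → N|_U`: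
families of linear maps `Γ(M, V) → Γ(N, V)` for `V ≤ U`, compatible with restrictions. -/
def localHom (M N : X.Modules) (U : X.Opens) :
    AddSubgroup (∀ V : {V : X.Opens // V ≤ U}, Γ(M, V.1) →ₗ[Γ(X, V.1)] Γ(N, V.1)) where
  carrier := {f | ∀ (V W : {V : X.Opens // V ≤ U}) (h : W.1 ≤ V.1) (s : Γ(M, V.1)),
    res N h (f V s) = f W (res M h s)}
  zero_mem' := by
    intro V W h s
    simp
  add_mem' := by
    intro f g hf hg V W h s
    simp [← hf V W h, ← hg V W h]
  neg_mem' := by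
    intro f hf V W h s
    simp [← hf V W h]

instance (M N : X.Modules) (U : X.Opens) : SMul Γ(X, U) (localHom M N U) where
  smul a f := ⟨fun V => resO V.2 a • f.1 V, by
    intro V W h s
    simp only [LinearMap.smul_apply]
    rw [res_smul, resO_resO, f.2 V W h]⟩

theorem localHom_smul_val (M N : X.Modules) (U : X.Opens) (a : Γ(X, U)) (f : localHom M N U)
    (V : {V : X.Opens // V ≤ U}) : (a • f).1 V = resO V.2 a • f.1 V := rfl

instance (M N : X.Modules) (U : X.Opens) : Module Γ(X, U) (localHom M N U) where
  one_smul f := by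
    ext V s
    simp [localHom_smul_val]
  mul_smul a b f := by
    ext V s
    simp [localHom_smul_val, mul_smul]
  smul_zero a := by
    ext V s
    simp [localHom_smul_val]
  smul_add a f g := by
    ext V s
    simp [localHom_smul_val]
  add_smul a b f := by
    ext V s
    simp [localHom_smul_val, add_smul]
  zero_smul f := by
    ext V s
    simp [localHom_smul_val]

/-- The restriction maps of `Hom(M, N)`. -/
def localHomRes (M N : X.Modules) {U V : X.Opens} (h : V ≤ U) :
    localHom M N U →+ localHom M N V where
  toFun f := ⟨fun W => f.1 ⟨W.1, W.2.trans h⟩, fun W W' h' s =>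
    f.2 ⟨W.1, W.2.trans h⟩ ⟨W'.1, W'.2.trans h⟩ h' s⟩
  map_zero' := rfl
  map_add' _ _ := rfl

theorem localHomRes_smul (M N : X.Modules) {U V : X.Opens} (h : V ≤ U) (a : Γ(X, U))
    (f : localHom M N U) : localHomRes M N h (a • f) = resO h a • localHomRes M N h f := by
  refine Subtype.ext (funext fun W => ?_)
  change resO _ a • _ = resO _ (resO _ a) • _
  rw [resO_resO]
  rfl

/-- `Hom(M, N)` as a presheaf of abelian groups. -/
def homPresheaf (M N : X.Modules) : TopCat.Presheaf Ab.{u} X where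
  obj U := AddCommGrpCat.of (localHom M N U.unop)
  map i := AddCommGrpCat.ofHom (localHomRes M N (leOfHom i.unop))

theorem eq_of_res_eq (N : X.Modules) {ι : Type u} {V : X.Opens} (W : ι → X.Opens)
    (hW : ∀ i, W i ≤ V) (hV : V ≤ iSup W) (s t : Γ(N, V))
    (h : ∀ i, res N (hW i) s = res N (hW i) t) : s = t :=
  TopCat.Sheaf.eq_of_locally_eq' ⟨N.presheaf, N.isSheaf⟩ W V (fun i => homOfLE (hW i)) hV s t h

theorem exists_glue (N : X.Modules) {ι : Type u} {V : X.Opens} (W : ι → X.Opens)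
    (hW : ∀ i, W i ≤ V) (hV : V ≤ iSup W) (s : ∀ i, Γ(N, W i))
    (h : ∀ i j, res N (inf_le_left : W i ⊓ W j ≤ W i) (s i) =
      res N (inf_le_right : W i ⊓ W j ≤ W j) (s j)) :
    ∃ t : Γ(N, V), ∀ i, res N (hW i) t = s i :=
  (TopCat.Sheaf.existsUnique_gluing' ⟨N.presheaf, N.isSheaf⟩ W V
    (fun i => homOfLE (hW i)) hV s h).exists

theorem homPresheaf_isSheaf (M N : X.Modules) : (homPresheaf M N).IsSheaf := by
  refine (TopCat.Presheaf.isSheaf_iff_isSheafUniqueGluing _).mpr fun ι U f hf => ?_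
  change ∀ i, localHom M N (U i) at f
  have hcov : ∀ V : X.Opens, V ≤ iSup U → V ≤ ⨆ i, V ⊓ U i := fun V hV => by
    rw [← inf_iSup_eq]
    exact le_inf le_rfl hV
  have hcomp : ∀ (i j : ι) (W : X.Opens) (hi : W ≤ U i) (hj : W ≤ U j),
      (f i).1 ⟨W, hi⟩ = (f j).1 ⟨W, hj⟩ := fun i j W hi hj =>
    congrFun (congrArg Subtype.val (hf i j)) ⟨W, le_inf hi hj⟩
  have key : ∀ (V : X.Opens) (hV : V ≤ iSup U) (s : Γ(M, V)), ∃ t : Γ(N, V), ∀ i,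
      res N (inf_le_left : V ⊓ U i ≤ V) t =
        (f i).1 ⟨V ⊓ U i, inf_le_right⟩ (res M inf_le_left s) := by
    intro V hV s
    refine exists_glue N (fun i => V ⊓ U i) (fun i => inf_le_left) (hcov V hV) _ fun i j => ?_
    rw [(f i).2 ⟨V ⊓ U i, inf_le_right⟩ ⟨(V ⊓ U i) ⊓ (V ⊓ U j), inf_le_left.trans inf_le_right⟩,
      (f j).2 ⟨V ⊓ U j, inf_le_right⟩ ⟨(V ⊓ U i) ⊓ (V ⊓ U j), inf_le_right.trans inf_le_right⟩,
      res_res, res_res, hcomp i j]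
  choose g hg using key
  have huniq : ∀ (V : X.Opens) (hV : V ≤ iSup U) (s : Γ(M, V)) (t : Γ(N, V)),
      (∀ i, res N (inf_le_left : V ⊓ U i ≤ V) t =
        (f i).1 ⟨V ⊓ U i, inf_le_right⟩ (res M inf_le_left s)) → t = g V hV s :=
    fun V hV s t ht => eq_of_res_eq N (fun i => V ⊓ U i) (fun i => inf_le_left) (hcov V hV) _ _
      fun i => (ht i).trans (hg V hV s i).symm
  refine ⟨(⟨fun V =>
    { toFun := g V.1 V.2
      map_add' := fun s t => (huniq _ _ _ _ fun i => by
        simp only [res, map_add]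
        exact congrArg₂ (· + ·) (hg V.1 V.2 s i) (hg V.1 V.2 t i)).symm
      map_smul' := fun a s => (huniq _ _ _ _ fun i => by
        rw [RingHom.id_apply, res_smul, res_smul, map_smul, hg]).symm }, ?_⟩ :
      localHom M N (iSup U)), ?_, ?_⟩
  · intro V W h s
    refine huniq _ _ _ _ fun i => ?_
    have h1 : W.1 ⊓ U i ≤ V.1 ⊓ U i := inf_le_inf_right _ h
    have h2 := congrArg (res N h1) (hg V.1 V.2 s i)
    rw [(f i).2 ⟨V.1 ⊓ U i, inf_le_right⟩ ⟨W.1 ⊓ U i, inf_le_right⟩ h1, res_res, res_res] at h2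
    rw [res_res M, res_res N]
    exact h2
  · intro i
    refine Subtype.ext (funext fun V => LinearMap.ext fun s => ?_)
    refine (huniq _ _ _ _ fun j => ?_).symm
    rw [(f i).2 V ⟨V.1 ⊓ U j, inf_le_left.trans V.2⟩, hcomp i j]
  · intro k hk
    refine Subtype.ext (funext fun V => LinearMap.ext fun s => ?_)
    refine huniq _ _ _ _ fun i => ?_
    have hki : localHomRes M N (le_iSup U i) k = f i := hk i
    rw [← hki]
    exact k.2 V ⟨V.1 ⊓ U i, inf_le_left.trans V.2⟩ inf_le_left s

instance (M N : X.Modules) (U : X.Opensᵒᵖ) :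
    Module (X.ringCatSheaf.obj.obj U) ((homPresheaf M N).obj U) :=
  inferInstanceAs (Module Γ(X, U.unop) (localHom M N U.unop))

/-- The sheaf `Hom(M, N)` of `𝒪_X`-linear morphisms. -/
def sheafHom (M N : X.Modules) : X.Modules where
  val := PresheafOfModules.ofPresheaf (homPresheaf M N) fun _ _ i a f =>
    localHomRes_smul M N (leOfHom i.unop) a f
  isSheaf := homPresheaf_isSheaf M N

/-! ### Quotient by torsion -/

/-- The torsion sections of `M` over `U`: those that vanish at the generic points of `X`. (For a
coherent sheaf on a curve these form its largest coherent subsheaf with finite support.) -/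
def torsionSections (M : X.Modules) (U : X.Opens) : Submodule Γ(X, U) Γ(M, U) where
  carrier := {s | ∀ (x : X) (hx : x ∈ U), x ∈ genericPoints X → M.presheaf.germ U x hx s = 0}
  zero_mem' := by
    intro x hx _
    simp
  add_mem' := by
    intro s t hs ht x hx hg
    simp [hs x hx hg, ht x hx hg]
  smul_mem' := by
    intro a s hs x hx hg
    rw [germ_smul, hs x hx hg, smul_zero]

/-- The torsion as a submodule of the presheaf of modules underlying `M`. -/
def torsionPresheaf (M : X.Modules) : PresheafOfModules.Submodule M.val where
  obj U := torsionSections M U.unop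
  map := by
    intro U V i s hs x hx hg
    exact (TopCat.Presheaf.germ_res_apply' M.presheaf i x hx s).trans
      (hs x (leOfHom i.unop hx) hg)

theorem torsionPresheaf_isSheaf (M : X.Modules) :
    TopCat.Presheaf.IsSheaf (X := X) (torsionPresheaf M).toPresheafOfModules.presheaf := by
  refine (TopCat.Presheaf.isSheaf_iff_isSheafUniqueGluing _).mpr fun ι U f hf => ?_
  change ∀ i, torsionSections M (U i) at f
  obtain ⟨t, ht⟩ := exists_glue M U (fun i => le_iSup U i) le_rfl (fun i => (f i).1)
    fun i j => congrArg Subtype.val (hf i j)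
  refine ⟨(⟨t, ?_⟩ : torsionSections M (iSup U)), fun i => Subtype.ext (ht i), fun k hk => ?_⟩
  · intro x hx hg
    obtain ⟨i, hi⟩ := Opens.mem_iSup.mp hx
    rw [← TopCat.Presheaf.germ_res_apply M.presheaf (homOfLE (le_iSup U i)) x hi t]
    exact (congrArg (M.presheaf.germ (U i) x hi) (ht i)).trans ((f i).2 x hi hg)
  · refine Subtype.ext (eq_of_res_eq M U (fun i => le_iSup U i) le_rfl _ _ fun i => ?_)
    exact (congrArg Subtype.val (hk i)).trans (ht i).symm

/-- The torsion subsheaf of `M`. -/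
def torsionSheaf (M : X.Modules) : X.Modules where
  val := (torsionPresheaf M).toPresheafOfModules
  isSheaf := torsionPresheaf_isSheaf M

/-- The inclusion of the torsion subsheaf. -/
def torsionι (M : X.Modules) : torsionSheaf M ⟶ M :=
  SheafOfModules.Hom.mk (torsionPresheaf M).ι

/-- `M` modulo torsion. -/
def modTorsion (M : X.Modules) : X.Modules := Limits.cokernel (torsionι M)

/-- `I^b`, that is, `b^* I` modulo torsion. -/
def pullbackModTorsion (b : Y ⟶ X) (M : X.Modules) : Y.Modules :=
  modTorsion ((Scheme.Modules.pullback b).obj M)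

/-! ### The conductor and products of ideals with modules -/

/-- The comorphism `b^# : 𝒪_X → b_* 𝒪_Y`, as a morphism of `𝒪_X`-modules. -/
def comorphism (b : Y ⟶ X) :
    structureSheaf X ⟶ (Scheme.Modules.pushforward b).obj (structureSheaf Y) :=
  SheafOfModules.unitToPushforwardObjUnit b.toRingCatSheafHom

/-- The annihilator of a sheaf of modules, as a sheaf of ideals. -/
def annihilator (M : X.Modules) (U : X.Opens) : Ideal Γ(X, U) where
  carrier := {a | ∀ (V : X.Opens) (h : V ≤ U) (s : Γ(M, V)), resO h a • s = 0}
  zero_mem' := by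
    intro V h s
    simp
  add_mem' := by
    intro a b ha hb V h s
    simp [add_smul, ha V h s, hb V h s]
  smul_mem' := by
    intro c a ha V h s
    simp [mul_smul, ha V h s]

/-- The conductor ideal of `b`: the annihilator of the cokernel of `b^#`. -/
def conductor (b : Y ⟶ X) (U : X.Opens) : Ideal Γ(X, U) :=
  annihilator (Limits.cokernel (comorphism b)) U

/-- The sections of `M` over `U` which locally belong to `P`. -/
def locallyIn (M : X.Modules) (P : ∀ U : X.Opens, Set Γ(M, U)) (U : X.Opens) : Set Γ(M, U) :=
  {s | ∀ x ∈ U, ∃ (V : X.Opens) (h : V ≤ U), x ∈ V ∧ res M h s ∈ P V}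

/-- The sections over `U` of the image sheaf of a morphism `φ : M ⟶ N`. -/
def image {M N : X.Modules} (φ : M ⟶ N) : ∀ U : X.Opens, Set Γ(N, U) :=
  locallyIn N fun V => Set.range (φ.app V)

/-- The sections over `U` of the subsheaf `F · M` of `M`, the image of `F ⊗ M → M`. -/
def idealMul (F : ∀ U : X.Opens, Ideal Γ(X, U)) (M : X.Modules) : ∀ U : X.Opens, Set Γ(M, U) :=
  locallyIn M fun V => (F V • (⊤ : Submodule Γ(X, V) Γ(M, V)) : Submodule Γ(X, V) Γ(M, V))

end

end CurveSheaf

/-!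
Write `J = Hom(I, 𝒪_C)` and let `U₀ ⊆ C` be a dense open subset over which `b` is an isomorphism;
its complement is a finite set of closed points. The idea is to find an invertible subsheaf `A` of
`J` which contains the product of the conductor with `J`, and to take for `L` the dual of `A` and
for `φ : I ⟶ L` the evaluation map `s ↦ (α ↦ α s)`.

*Construction of `A`.* The pullback `J → b_* J^b` is injective, since `J` has no torsion and `b`
is an isomorphism at the generic points (`pullSection_injective`). The fibres of the closed
morphism `b` are finite and `k` is infinite, so near each point `x` a general section `g x` of `J`
generates the invertible sheaf `J^b` on the preimage of a neighbourhood of `x`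
(`exists_isFreeGenerator_pullSection`). Let `A` consist of the sections of `J` which are multiples
of `g x` near each of the finitely many points `x ∉ U₀` (`locallyGenerated`). It is freely
generated by `g x` near `x`. If `a` lies in the conductor and `h` in `J`, the pullback of `h` is
`u • g x` for some function `u` upstairs, and `a u` comes from a function `c` downstairs, so
`a h = c • g x` lies in `A` (`exists_conductor_generator`).

*Injectivity of `φ`.* At a generic point of `C` the local ring is a field and `I` is free of rank
one, so a nonzero functional is injective; and `I` has no torsion sections, because its associated
points are generic (`torsionSections_eq_bot`, `mono_evalMorphism`).

*The image of `φ`.* A section `l` of `L` and a function `a` in the conductor define the functional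
`h ↦ l (a h)` on `J`. The local rings of `C` are Gorenstein of dimension at most one, so finite
modules over them surject onto their biduals (`GorensteinDuality.exists_eval`). The functional is
therefore evaluation at some element of the stalk of `I`, whose image under `φ` is `a l`
(`exists_evalMorphism_eq`). The surjectivity on biduals holds because finite injective dimension
forces `Ext²(N, R) = 0` for every finite module `N` (`GorensteinDuality.ExtVanishes.two`): the
dual of a module with a finite presentation is the kernel of a matrix, and this vanishing lets
functionals on such a kernel extend to the ambient free module.
-/

/-! ### Duality over one-dimensional Gorenstein local rings -/

namespace GorensteinDuality

open CategoryTheory.Abelian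

section Ring

variable (R : Type u) [CommRing R]

/-- `Ext^i_R(N, R) = 0`. -/
def ExtVanishes (N : Type u) [AddCommGroup N] [Module R N] (i : ℕ) : Prop :=
  ∀ e : Ext.{u} (ModuleCat.of R N) (ModuleCat.of R R) i, e = 0

variable {R}
variable {N₁ N₂ N₃ : Type u} [AddCommGroup N₁] [Module R N₁] [AddCommGroup N₂] [Module R N₂]
  [AddCommGroup N₃] [Module R N₃]

theorem exists_shortExact (f : N₁ →ₗ[R] N₂) (g : N₂ →ₗ[R] N₃) (hf : Function.Injective f)
    (hg : Function.Surjective g) (hfg : Function.Exact f g) :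
    (ModuleCat.shortComplexOfCompEqZero f g hfg.linearMap_comp_eq_zero).ShortExact :=
  ModuleCat.shortComplex_shortExact _ hfg hf hg

theorem ExtVanishes.middle {f : N₁ →ₗ[R] N₂} {g : N₂ →ₗ[R] N₃} (hf : Function.Injective f)
    (hg : Function.Surjective g) (hfg : Function.Exact f g) {i : ℕ}
    (h₁ : ExtVanishes R N₁ i) (h₃ : ExtVanishes R N₃ i) : ExtVanishes R N₂ i := by
  intro e
  obtain ⟨e', rfl⟩ := Ext.contravariant_sequence_exact₂ (exists_shortExact f g hf hg hfg)
    (ModuleCat.of R R) e (h₁ _)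
  rw [h₃ e', Ext.comp_zero]

theorem ExtVanishes.left {f : N₁ →ₗ[R] N₂} {g : N₂ →ₗ[R] N₃} (hf : Function.Injective f)
    (hg : Function.Surjective g) (hfg : Function.Exact f g) {i : ℕ}
    (h₂ : ExtVanishes R N₂ i) (h₃ : ExtVanishes R N₃ (i + 1)) : ExtVanishes R N₁ i := by
  intro e
  obtain ⟨e', rfl⟩ := Ext.contravariant_sequence_exact₁ (exists_shortExact f g hf hg hfg)
    (ModuleCat.of R R) e (add_comm 1 i) (h₃ _)
  rw [h₂ e', Ext.comp_zero]

theorem ExtVanishes.right {f : N₁ →ₗ[R] N₂} {g : N₂ →ₗ[R] N₃} (hf : Function.Injective f)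
    (hg : Function.Surjective g) (hfg : Function.Exact f g) {i : ℕ}
    (h₁ : ExtVanishes R N₁ i) (h₂ : ExtVanishes R N₂ (i + 1)) : ExtVanishes R N₃ (i + 1) := by
  intro e
  obtain ⟨e', rfl⟩ := Ext.contravariant_sequence_exact₃ (exists_shortExact f g hf hg hfg)
    (ModuleCat.of R R) e (h₂ _) (add_comm 1 i)
  rw [h₁ e', Ext.comp_zero]

theorem ExtVanishes.of_projective [Module.Projective R N₁] {i : ℕ} (hi : 0 < i) :
    ExtVanishes R N₁ i := by
  obtain ⟨j, rfl⟩ := Nat.exists_eq_succ_of_ne_zero hi.ne'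
  intro e
  have : Projective (ModuleCat.of R N₁) :=
    (IsProjective.iff_projective _).mp (inferInstanceAs (Module.Projective R N₁))
  exact Ext.eq_zero_of_projective e

theorem ExtVanishes.of_equiv (e : N₁ ≃ₗ[R] N₂) {i : ℕ} (h : ExtVanishes R N₂ i) :
    ExtVanishes R N₁ i := by
  refine ExtVanishes.middle (f := (0 : PUnit.{u + 1} →ₗ[R] N₁)) (g := e.toLinearMap)
    (Function.injective_of_subsingleton _) e.surjective ?_ ?_ h
  · exact (LinearMap.exact_zero_iff_injective _ _).mpr e.injective
  · intro e
    have : Limits.IsZero (ModuleCat.of R PUnit.{u + 1}) := ModuleCat.isZero_of_subsingleton _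
    rw [← Ext.mk₀_id_comp e, this.eq_zero_of_src (𝟙 _), Ext.mk₀_zero, Ext.zero_comp]

theorem ExtVanishes.of_injective {f : N₁ →ₗ[R] N₂} (hf : Function.Injective f) {i : ℕ}
    (h₂ : ExtVanishes R N₂ i) (h₃ : ExtVanishes R (N₂ ⧸ LinearMap.range f) (i + 1)) :
    ExtVanishes R N₁ i :=
  ExtVanishes.left hf (Submodule.mkQ_surjective _) (LinearMap.exact_map_mkQ_range f) h₂ h₃

end Ring

variable {R : Type u} [CommRing R] [IsNoetherianRing R]

/-- An associated prime `p` of `M` gives an embedding of `R / p` into `M`, along which the vanishing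
of `Ext^n` descends. -/
theorem ExtVanishes.quotient_of_mem_associatedPrimes {n : ℕ}
    (h : ∀ (N : Type u) [AddCommGroup N] [Module R N] [Module.Finite R N],
      ExtVanishes R N (n + 1)) {p : Ideal R} {M : Type u} [AddCommGroup M] [Module R M]
    [Module.Finite R M] (hM : ExtVanishes R M n) (hp : p ∈ associatedPrimes R M) :
    ExtVanishes R (R ⧸ p) n := by
  obtain ⟨-, x, hx⟩ := isAssociatedPrime_iff.mp hp
  have hx' : p = LinearMap.ker (LinearMap.toSpanSingleton R M x) := by
    rw [hx]
    ext
    simp [Submodule.mem_colon_singleton]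
  refine ExtVanishes.of_injective
    (f := p.liftQ (LinearMap.toSpanSingleton R M x) hx'.le) ?_ hM (h _)
  rw [← LinearMap.ker_eq_bot, Submodule.ker_liftQ_eq_bot]
  exact hx'.ge

variable [IsLocalRing R]

/-- Over a noetherian local ring of dimension at most one, the injective dimension of `R` can be
lowered as long as it exceeds one: for a regular parameter `t`, the residue field embeds into
`R / t`, whose projective dimension is one. -/
theorem ExtVanishes.of_succ (hdim : ∀ p : Ideal R, p.IsPrime →
      p ∈ minimalPrimes R ∨ p = IsLocalRing.maximalIdeal R) {n : ℕ} (hn : 2 ≤ n)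
    (h : ∀ (N : Type u) [AddCommGroup N] [Module R N] [Module.Finite R N],
      ExtVanishes R N (n + 1))
    (N : Type u) [AddCommGroup N] [Module R N] [hN : Module.Finite R N] : ExtVanishes R N n := by
  induction hN using IsNoetherianRing.induction_on_isQuotientEquivQuotientPrime R with
  | subsingleton N =>
    exact .of_equiv (N₂ := PUnit.{u + 1}) (LinearEquiv.ofSubsingleton _ _)
      (.of_projective (by lia))
  | exact N₁ N₂ N₃ f g hf hg hfg h₁ h₃ => exact .middle hf hg hfg h₁ h₃
  | quotient N p e =>
    refine .of_equiv e ?_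
    by_cases hp : p.1 ∈ associatedPrimes R R
    · exact .quotient_of_mem_associatedPrimes h (.of_projective (by lia)) hp
    · have hmin : ∀ q ∈ minimalPrimes R, q ∈ associatedPrimes R R := fun q hq => by
        refine Module.associatedPrimes.minimalPrimes_annihilator_subset_associatedPrimes R R ?_
        rw [Module.annihilator_eq_bot.mpr inferInstance]
        exact hq
      have hpm : p.1 = IsLocalRing.maximalIdeal R :=
        (hdim p.1 p.2).resolve_left fun hq => hp (hmin _ hq)
      obtain ⟨t, htp, ht⟩ : ∃ t ∈ p.1, t ∈ nonZeroDivisors R := by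
        by_contra! hcon
        -- If `p` consisted of zero divisors, prime avoidance would put it in an associated prime.
        have hsub : (p.1 : Set R) ⊆ ⋃ q ∈ associatedPrimes R R, (q : Set R) := by
          rw [biUnion_associatedPrimes_eq_compl_nonZeroDivisors]
          exact fun t ht => hcon t ht
        obtain ⟨q, hq, hpq⟩ := (Ideal.subset_union_prime_finite
          (associatedPrimes.finite R R) 0 0 (fun q hq _ _ => hq.isPrime)).mp hsub
        have hqm := IsLocalRing.le_maximalIdeal hq.isPrime.ne_top
        exact hp (le_antisymm hpq (hpm ▸ hqm) ▸ hq)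
      have hnt : Nontrivial (R ⧸ Ideal.span {t}) :=
        Ideal.Quotient.nontrivial_iff.mpr fun htop => p.2.ne_top
          (top_le_iff.mp (htop ▸ (Ideal.span_singleton_le_iff_mem _).mpr htp))
      obtain ⟨q, hq⟩ := associatedPrimes.nonempty R (R ⧸ Ideal.span {t})
      have htq : t ∈ q := by
        obtain ⟨-, x, rfl⟩ := isAssociatedPrime_iff.mp hq
        obtain ⟨y, rfl⟩ := Ideal.Quotient.mk_surjective x
        rw [Submodule.mem_colon_singleton, Submodule.mem_bot, Algebra.smul_def,
          Ideal.Quotient.algebraMap_eq, ← map_mul, Ideal.Quotient.eq_zero_iff_mem]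
        exact Ideal.mul_mem_right _ _ (Ideal.mem_span_singleton_self t)
      have hqp : q = p.1 := by
        rw [hpm]
        exact (hdim q hq.isPrime).resolve_left fun hq' =>
          notMem_nonZeroDivisors_of_mem_mem_minimalPrimes htq hq' ht
      refine .quotient_of_mem_associatedPrimes (M := R ⧸ Ideal.span {t}) h ?_ (hqp ▸ hq)
      obtain ⟨m, rfl⟩ : ∃ m, n = m + 1 := ⟨n - 1, by lia⟩
      refine .right (f := LinearMap.mulLeft R t) (g := (Ideal.span {t}).mkQ) ?_
        (Submodule.mkQ_surjective _) ?_ (.of_projective (by lia)) (.of_projective (by lia))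
      · intro a b hab
        exact (mul_cancel_left_mem_nonZeroDivisors ht).mp hab
      · rw [LinearMap.exact_iff, Submodule.ker_mkQ]
        ext a
        simp [Ideal.mem_span_singleton', mul_comm]

/-- A noetherian local ring of dimension at most one and of finite injective dimension over itself
has injective dimension at most one. -/
theorem ExtVanishes.two (hdim : ∀ p : Ideal R, p.IsPrime →
      p ∈ minimalPrimes R ∨ p = IsLocalRing.maximalIdeal R)
    (hG : ∃ n : ℕ, HasInjectiveDimensionLE (ModuleCat.of R R) n)
    (N : Type u) [AddCommGroup N] [Module R N] [hN : Module.Finite R N] : ExtVanishes R N 2 := by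
  obtain ⟨n, hn⟩ := hG
  have key : ∀ d : ℕ, ∀ (N : Type u) [AddCommGroup N] [Module R N] [Module.Finite R N],
      ∀ i, n + 1 ≤ i + d → 2 ≤ i → ExtVanishes R N i := by
    intro d
    induction d with
    | zero =>
      intro N _ _ _ i hi _ e
      exact e.eq_zero_of_hasInjectiveDimensionLT (n + 1) hi
    | succ d ih =>
      intro N _ _ _ i hi h2
      exact .of_succ hdim h2 (fun N _ _ _ => ih N (i + 1) (by lia) (by lia)) N
  exact key n N 2 (by lia) le_rfl

/-- Over a one-dimensional Gorenstein local ring, linear functionals on the kernel of a matrix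
extend to the whole free module. -/
theorem exists_extend_of_ker (hdim : ∀ p : Ideal R, p.IsPrime →
      p ∈ minimalPrimes R ∨ p = IsLocalRing.maximalIdeal R)
    (hG : ∃ n : ℕ, HasInjectiveDimensionLE (ModuleCat.of R R) n)
    {F G : Type u} [AddCommGroup F] [Module R F] [AddCommGroup G] [Module R G]
    [Module.Finite R G] [Module.Free R G]
    (α : F →ₗ[R] G) (ψ : LinearMap.ker α →ₗ[R] R) :
    ∃ χ : F →ₗ[R] R, ∀ w : LinearMap.ker α, χ w = ψ w := by
  -- The obstruction lies in `Ext¹` of the image of `α`, which embeds in `Ext²` of the cokernel.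
  have h₁ : ExtVanishes R (LinearMap.range α) 1 :=
    .of_injective (f := (LinearMap.range α).subtype) (Submodule.injective_subtype _)
      (.of_projective one_pos) (.two hdim hG _)
  have hS := exists_shortExact (LinearMap.ker α).subtype α.rangeRestrict
    (Submodule.injective_subtype _) α.surjective_rangeRestrict (by
      rw [LinearMap.exact_iff, LinearMap.ker_rangeRestrict, Submodule.range_subtype])
  obtain ⟨e, he⟩ := Ext.contravariant_sequence_exact₁ hS (ModuleCat.of R R)
    (Ext.mk₀ (ModuleCat.ofHom ψ)) (add_zero 1) (h₁ _)
  obtain ⟨χ, rfl⟩ := (Ext.mk₀_bijective _ _).2 e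
  rw [Ext.mk₀_comp_mk₀] at he
  have he' := (Ext.mk₀_bijective _ _).1 he
  exact ⟨χ.hom, fun w => congr($he' w)⟩

/-- Over a one-dimensional Gorenstein local ring, a finite module maps onto its bidual. -/
theorem exists_eval (hdim : ∀ p : Ideal R, p.IsPrime →
      p ∈ minimalPrimes R ∨ p = IsLocalRing.maximalIdeal R)
    (hG : ∃ n : ℕ, HasInjectiveDimensionLE (ModuleCat.of R R) n)
    {M : Type u} [AddCommGroup M] [Module R M] [Module.Finite R M]
    (Ψ : (M →ₗ[R] R) →ₗ[R] R) : ∃ m : M, ∀ θ, Ψ θ = θ m := by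
  obtain ⟨n, π, hπ⟩ := Module.Finite.exists_fin' R M
  obtain ⟨l, ρ, hρ⟩ := Module.Finite.exists_fin' R (LinearMap.ker π)
  -- The dual of `M` is the kernel of the transpose of a presentation of `M`.
  let α : ((Fin n → R) →ₗ[R] R) →ₗ[R] ((Fin l → R) →ₗ[R] R) :=
    LinearMap.lcomp R R ((LinearMap.ker π).subtype ∘ₗ ρ)
  have hdesc : ∀ w : LinearMap.ker α, ∃ θ : M →ₗ[R] R, θ ∘ₗ π = w := by
    rintro ⟨w, hw⟩
    have hw' : LinearMap.ker π ≤ LinearMap.ker w := by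
      intro r hr
      obtain ⟨c, hc⟩ := hρ ⟨r, hr⟩
      have := LinearMap.congr_fun (LinearMap.mem_ker.mp hw) c
      simpa [α, hc] using this
    refine ⟨(LinearMap.ker π).liftQ w hw' ∘ₗ
      (π.quotKerEquivOfSurjective hπ).symm.toLinearMap, LinearMap.ext fun r => ?_⟩
    have : (π.quotKerEquivOfSurjective hπ).symm (π r) = Submodule.Quotient.mk r := by
      rw [LinearEquiv.symm_apply_eq]
      rfl
    simp [this]
  choose desc hd using hdesc
  have hd' : ∀ (w : LinearMap.ker α) (θ : M →ₗ[R] R), θ ∘ₗ π = w → desc w = θ := by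
    intro w θ hθ
    rw [← LinearMap.cancel_right hπ, hd, hθ]
  let ψ : LinearMap.ker α →ₗ[R] R :=
    { toFun := fun w => Ψ (desc w)
      map_add' := fun v w => by
        rw [hd' (v + w) (desc v + desc w) (by rw [LinearMap.add_comp, hd, hd]; rfl), map_add]
      map_smul' := fun a w => by
        rw [hd' (a • w) (a • desc w) (by rw [LinearMap.smul_comp, hd]; rfl), map_smul]
        rfl }
  obtain ⟨χ, hχ⟩ := exists_extend_of_ker hdim hG α ψ
  let c : Fin n → R := fun i => χ (LinearMap.proj i)
  refine ⟨π c, fun θ => ?_⟩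
  have hmem : θ ∘ₗ π ∈ LinearMap.ker α := by
    refine LinearMap.mem_ker.mpr (LinearMap.ext fun r => ?_)
    simp [α]
  have h1 := hχ ⟨θ ∘ₗ π, hmem⟩
  have h2 : ψ ⟨θ ∘ₗ π, hmem⟩ = Ψ θ := congrArg Ψ (hd' _ θ rfl)
  have h3 : θ ∘ₗ π = ∑ i, (θ ∘ₗ π) (fun j => if i = j then 1 else 0) • LinearMap.proj i := by
    refine LinearMap.ext fun r => ?_
    conv_lhs => rw [LinearMap.pi_apply_eq_sum_univ (θ ∘ₗ π) r]
    simp [mul_comm]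
  have h4 := LinearMap.pi_apply_eq_sum_univ (θ ∘ₗ π) c
  rw [← h2, ← h1, ← LinearMap.comp_apply θ π, h4]
  change χ (θ ∘ₗ π) = _
  conv_lhs => rw [h3]
  simp [c, mul_comm]

/-- A functional on the dual of a finite `B`-module is, at a prime where `B` is Gorenstein of
dimension at most one, the evaluation at a fraction. -/
theorem exists_eval_at_prime {B : Type u} [CommRing B] [IsNoetherianRing B] (q : Ideal B)
    [q.IsPrime] [Algebra B R] [IsLocalization.AtPrime R q]
    (hdim : ∀ p : Ideal R, p.IsPrime →
      p ∈ minimalPrimes R ∨ p = IsLocalRing.maximalIdeal R)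
    (hG : ∃ n : ℕ, HasInjectiveDimensionLE (ModuleCat.of R R) n)
    {M : Type u} [AddCommGroup M] [Module B M] [Module.Finite B M]
    (Ψ : (M →ₗ[B] B) →ₗ[B] B) :
    ∃ (m : M) (s : B), s ∉ q ∧ ∀ θ, algebraMap B R (s * Ψ θ) = algebraMap B R (θ m) := by
  have hM : Module.FinitePresentation B M := Module.finitePresentation_of_finite B M
  -- Localizing twice: `Ψ'` is the functional that `Ψ` induces on the dual of `R ⊗ M`.
  let mk := IsLocalizedModule.mapExtendScalars q.primeCompl (TensorProduct.mk B R M 1)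
    (Algebra.linearMap B R) R
  let Ψ' := IsLocalizedModule.mapExtendScalars q.primeCompl mk (Algebra.linearMap B R) R Ψ
  obtain ⟨t, ht⟩ := exists_eval hdim hG Ψ'
  obtain ⟨⟨m, s⟩, hs⟩ := IsLocalizedModule.surj q.primeCompl (TensorProduct.mk B R M 1) t
  refine ⟨m, s, s.2, fun θ => ?_⟩
  have h1 : Ψ' (mk θ) = algebraMap B R (Ψ θ) := by
    simp [Ψ', mk]
  have h2 : mk θ (TensorProduct.mk B R M 1 m) = algebraMap B R (θ m) :=
    IsLocalizedModule.map_apply q.primeCompl _ (Algebra.linearMap B R) θ m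
  rw [← h2, ← hs, map_mul, ← h1, ht, Submonoid.smul_def, ← algebraMap_smul R (s : B) t,
    map_smul, smul_eq_mul]

end GorensteinDuality

/-! ### Points of curves -/

namespace CurveSheaf

section Topology

variable {α : Type*} [TopologicalSpace α]

theorem exists_genericPoints_specializes [QuasiSober α] (x : α) :
    ∃ η ∈ genericPoints α, η ⤳ x := by
  let η := genericPoints.ofComponent
    ⟨irreducibleComponent x, irreducibleComponent_mem_irreducibleComponents x⟩
  refine ⟨η.1, η.2, ?_⟩
  rw [specializes_iff_mem_closure, (genericPoints.isGenericPoint_ofComponent _).def]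
  exact mem_irreducibleComponent

theorem genericPoints_subset_of_dense [NoetherianSpace α] {U : Set α} (hU : IsOpen U)
    (hd : Dense U) : genericPoints α ⊆ U := by
  intro x hx
  by_contra hxU
  have hcl : closure {x} ⊆ Uᶜ :=
    closure_minimal (Set.singleton_subset_iff.mpr hxU) hU.isClosed_compl
  -- The complement of the components other than `closure {x}` is an open neighbourhood of `x`.
  let W : Set α := (⋃₀ (irreducibleComponents α \ {closure {x}}))ᶜ
  have hW : IsOpen W := by
    refine IsClosed.isOpen_compl (self := ?_)
    rw [Set.sUnion_eq_biUnion]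
    refine Set.Finite.isClosed_biUnion (NoetherianSpace.finite_irreducibleComponents.subset
      Set.sdiff_subset) fun Z hZ => isClosed_of_mem_irreducibleComponents Z hZ.1
  have hxW : x ∈ W := by
    rintro ⟨Z, ⟨hZ, hne⟩, hxZ⟩
    have hle : closure {x} ⊆ Z := closure_minimal (Set.singleton_subset_iff.mpr hxZ)
      (isClosed_of_mem_irreducibleComponents Z hZ)
    exact hne (Set.Subset.antisymm (hx.2 hZ.1 hle) hle)
  obtain ⟨y, hyW, hyU⟩ := hd.inter_open_nonempty W hW ⟨x, hxW⟩
  refine hcl ?_ hyU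
  by_contra hy
  exact hyW ⟨irreducibleComponent y, ⟨irreducibleComponent_mem_irreducibleComponents y,
    fun h => hy (h ▸ mem_irreducibleComponent)⟩, mem_irreducibleComponent⟩

/-- On a space of dimension one there are no proper chains of two specializations. -/
theorem eq_or_eq_of_specializes [T0Space α]
    (h : ∀ Z ∈ irreducibleComponents α, topologicalKrullDim Z = 1) {x y z : α}
    (hxy : x ⤳ y) (hyz : y ⤳ z) : x = y ∨ y = z := by
  by_contra! hne
  let Z := irreducibleComponent x
  have hcl : closure {x} ⊆ Z := closure_minimal
    (Set.singleton_subset_iff.mpr mem_irreducibleComponent) isClosed_irreducibleComponent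
  let c : Z → IrreducibleCloseds Z := fun w =>
    ⟨closure {w}, isIrreducible_singleton.closure, isClosed_closure⟩
  have hc : ∀ v w : Z, v.1 ⤳ w.1 → v.1 ≠ w.1 → c w < c v := by
    intro v w hvw hne
    have hs : v ⤳ w := Topology.IsInducing.subtypeVal.specializes_iff.mp hvw
    refine lt_of_le_of_ne (hs.closure_subset : closure {w} ⊆ closure {v}) fun heq => hne ?_
    have hcl : closure {w} = closure {v} :=
      congrArg (fun t : IrreducibleCloseds Z => (t : Set Z)) heq
    exact congrArg Subtype.val
      (hs.antisymm (specializes_iff_closure_subset.mpr hcl.ge)).eq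
  let s : LTSeries (IrreducibleCloseds Z) :=
    { length := 2
      toFun := ![c ⟨z, hcl (hxy.trans hyz).mem_closure⟩, c ⟨y, hcl hxy.mem_closure⟩,
        c ⟨x, mem_irreducibleComponent⟩]
      step := by
        intro i
        fin_cases i
        · exact hc ⟨y, _⟩ ⟨z, _⟩ hyz hne.2
        · exact hc ⟨x, _⟩ ⟨y, _⟩ hxy hne.1 }
  have h2 : (2 : WithBot ℕ∞) ≤ topologicalKrullDim Z := Order.LTSeries.length_le_krullDim s
  rw [h Z (irreducibleComponent_mem_irreducibleComponents x)] at h2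
  exact absurd h2 (by decide)

variable [NoetherianSpace α] [QuasiSober α] [T0Space α]
  (h : ∀ Z ∈ irreducibleComponents α, topologicalKrullDim Z = 1)

include h in
/-- A point outside a dense open subset of a one-dimensional space is closed. -/
theorem isClosed_singleton_of_notMem_dense {U : Set α} (hU : IsOpen U) (hd : Dense U) {y : α}
    (hy : y ∉ U) : IsClosed {y} := by
  obtain ⟨η, hη, hηy⟩ := exists_genericPoints_specializes y
  have hne : η ≠ y := fun he => hy (he ▸ genericPoints_subset_of_dense hU hd hη)
  refine isClosed_of_closure_subset fun z hz => ?_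
  have hyz : y ⤳ z := specializes_iff_mem_closure.mpr hz
  exact ((eq_or_eq_of_specializes h hηy hyz).resolve_left hne).symm

include h in
/-- A closed subset of a one-dimensional noetherian space without interior is finite. -/
theorem finite_compl_of_dense {U : Set α} (hU : IsOpen U) (hd : Dense U) : Uᶜ.Finite := by
  obtain ⟨S, hS, hirr, heq⟩ :=
    NoetherianSpace.exists_finite_set_closeds_irreducible ⟨Uᶜ, hU.isClosed_compl⟩
  have hle : ∀ t ∈ S, (t : Set α) ⊆ Uᶜ := fun t ht => (le_sSup ht).trans heq.ge
  have hsing : ∀ t ∈ S, (t : Set α).Finite := by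
    intro t ht
    obtain ⟨y, hy⟩ := QuasiSober.sober (hirr t ht) t.isClosed
    have hyt : y ∈ (t : Set α) := hy.mem
    rw [← hy.def, (isClosed_singleton_of_notMem_dense h hU hd (hle t ht hyt)).closure_eq]
    exact Set.finite_singleton y
  refine (hS.biUnion hsing).subset fun x hx => ?_
  have hxs : x ∈ ((sSup S : Closeds α) : Set α) := heq ▸ hx
  lift S to Finset (Closeds α) using hS
  rw [← Finset.sup_id_eq_sSup, Closeds.coe_finset_sup] at hxs
  simpa using hxs

end Topology

section Scheme

variable {X : Scheme.{u}}

/-- The local rings at the generic points of a reduced scheme are fields. -/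
theorem eq_zero_or_isUnit_of_mem_genericPoints [IsReduced X] {η : X} (hη : η ∈ genericPoints X)
    (r : X.presheaf.stalk η) : r = 0 ∨ IsUnit r := by
  by_contra! hr
  refine hr.1 (IsNilpotent.eq_zero ?_)
  rw [nilpotent_iff_mem_prime]
  intro J hJ
  have hsp : X.fromSpecStalk η ⟨J, hJ⟩ ⤳ η :=
    (X.range_fromSpecStalk (x := η)).le ⟨_, rfl⟩
  have heq : X.fromSpecStalk η ⟨J, hJ⟩ = η := by
    have hcl := hη.2 (isIrreducible_singleton (x := X.fromSpecStalk η ⟨J, hJ⟩)).closure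
      (specializes_iff_closure_subset.mp hsp)
    exact (hsp.antisymm (specializes_iff_closure_subset.mpr hcl)).eq
  have : (⟨J, hJ⟩ : PrimeSpectrum _) = IsLocalRing.closedPoint _ :=
    (X.fromSpecStalk η).isEmbedding.injective
      (heq.trans (Scheme.fromSpecStalk_closedPoint (x := η)).symm)
  have hJm : J = IsLocalRing.maximalIdeal _ := congrArg PrimeSpectrum.asIdeal this
  rw [hJm]
  exact hr.2

/-- The local rings of a one-dimensional scheme have dimension at most one. -/
theorem mem_minimalPrimes_or_eq_maximalIdeal
    (h : ∀ Z ∈ irreducibleComponents X, topologicalKrullDim Z = 1) (x : X)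
    (P : Ideal (X.presheaf.stalk x)) (hP : P.IsPrime) :
    P ∈ minimalPrimes (X.presheaf.stalk x) ∨ P = IsLocalRing.maximalIdeal _ := by
  by_cases hm : P ∈ minimalPrimes (X.presheaf.stalk x)
  · exact Or.inl hm
  right
  obtain ⟨Q, hQ, hQP⟩ := Ideal.exists_minimalPrimes_le (I := ⊥) (J := P) bot_le
  have hQ' : Q.IsPrime := hQ.1.1
  have hne : Q ≠ P := fun he => hm (he ▸ hQ)
  let j := X.fromSpecStalk x
  have hj : Function.Injective j := j.isEmbedding.injective
  have h1 : j ⟨Q, hQ'⟩ ⤳ j ⟨P, hP⟩ :=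
    ((PrimeSpectrum.le_iff_specializes ⟨Q, hQ'⟩ ⟨P, hP⟩).mp hQP).map j.continuous
  have h2 : j ⟨P, hP⟩ ⤳ j (IsLocalRing.closedPoint _) :=
    (IsLocalRing.specializes_closedPoint _).map j.continuous
  rcases eq_or_eq_of_specializes h h1 h2 with h | h
  · exact absurd (congrArg PrimeSpectrum.asIdeal (hj h)) hne
  · exact congrArg PrimeSpectrum.asIdeal (hj h)

/-- On a reduced scheme, a function vanishing near all generic points vanishes. -/
theorem eq_zero_of_genericPoints [IsReduced X] {U : X.Opens} (a : Γ(X, U))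
    (h : ∀ (η : X) (hη : η ∈ U), η ∈ genericPoints X → X.presheaf.germ U η hη a = 0) : a = 0 := by
  rw [← AlgebraicGeometry.basicOpen_eq_bot_iff]
  by_contra hne
  have hne' : (X.basicOpen a : Set X).Nonempty := by
    rw [Set.nonempty_iff_ne_empty]
    exact fun he => hne (Opens.ext he)
  obtain ⟨η, hηa, hη⟩ := (dense_iff_closure_eq.mpr genericPoints.closure).inter_open_nonempty _
    (X.basicOpen a).isOpen hne'
  have hηU := X.basicOpen_le a hηa
  have := (X.mem_basicOpen a η hηU).mp hηa
  rw [h η hηU hη] at this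
  exact not_isUnit_zero this

end Scheme

section Projective

attribute [local instance] MvPolynomial.gradedAlgebra

theorem isProper_projSpaceStr (k : Type u) [Field k] (n : ℕ) : IsProper (projSpaceStr k n) := by
  let 𝒜 := MvPolynomial.homogeneousSubmodule (Fin (n + 1)) k
  have htow : IsScalarTower k (𝒜 0) (MvPolynomial (Fin (n + 1)) k) :=
    ⟨fun a x y => smul_mul_assoc a (x : MvPolynomial (Fin (n + 1)) k) y⟩
  have hft : Algebra.FiniteType (𝒜 0) (MvPolynomial (Fin (n + 1)) k) :=
    Algebra.FiniteType.of_restrictScalars_finiteType k _ _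
  have hs : Function.Surjective (algebraMap k (𝒜 0)) := by
    rintro ⟨f, hf⟩
    obtain ⟨c, hc⟩ : ∃ c, MvPolynomial.C c = f :=
      ⟨_, (MvPolynomial.totalDegree_eq_zero_iff_eq_C.mp
        (Nat.le_zero.mp (MvPolynomial.IsHomogeneous.totalDegree_le hf))).symm⟩
    exact ⟨c, Subtype.ext hc⟩
  have hc : IsClosedImmersion (Spec.map (CommRingCat.ofHom (algebraMap k (𝒜 0)))) :=
    IsClosedImmersion.spec_of_surjective _ hs
  exact inferInstanceAs (IsProper (Proj.toSpecZero 𝒜 ≫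
    Spec.map (CommRingCat.ofHom (algebraMap k (𝒜 0)))))

theorem IsProjective.isProper {k : Type u} [Field k] {X : Scheme.{u}} {p : X ⟶ Spec (.of k)}
    (h : IsProjective p) : IsProper p := by
  obtain ⟨n, i, hi, rfl⟩ := h
  have := isProper_projSpaceStr k n
  infer_instance

theorem IsProjective.isNoetherian {k : Type u} [Field k] {X : Scheme.{u}}
    {p : X ⟶ Spec (.of k)} (h : IsProjective p) : IsNoetherian X := by
  have := h.isProper
  have hl : IsLocallyNoetherian X := LocallyOfFiniteType.isLocallyNoetherian p
  have hc : CompactSpace X := QuasiCompact.compactSpace_of_compactSpace p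
  exact { }

end Projective

end CurveSheaf

/-! ### Sections of sheaves of modules -/

namespace CurveSheaf

noncomputable section

variable {X Y : Scheme.{u}}

theorem res_self (M : X.Modules) {U : X.Opens} (h : U ≤ U) (s : Γ(M, U)) : res M h s = s := by
  simp [res]

theorem res_add (M : X.Modules) {U V : X.Opens} (h : V ≤ U) (s t : Γ(M, U)) :
    res M h (s + t) = res M h s + res M h t := map_add _ _ _

theorem res_sub (M : X.Modules) {U V : X.Opens} (h : V ≤ U) (s t : Γ(M, U)) :
    res M h (s - t) = res M h s - res M h t := map_sub _ _ _

theorem res_zero (M : X.Modules) {U V : X.Opens} (h : V ≤ U) : res M h (0 : Γ(M, U)) = 0 :=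
  map_zero _

theorem resO_mul {U V : X.Opens} (h : V ≤ U) (a b : Γ(X, U)) :
    resO h (a * b) = resO h a * resO h b := map_mul _ _ _

theorem app_res {M N : X.Modules} (φ : M ⟶ N) {U V : X.Opens} (h : V ≤ U) (s : Γ(M, U)) :
    φ.app V (res M h s) = res N h (φ.app U s) :=
  congr($(φ.mapPresheaf.naturality (homOfLE h).op) s)

theorem eq_of_locally_eq (N : X.Modules) {U : X.Opens} (s t : Γ(N, U))
    (h : ∀ x ∈ U, ∃ (V : X.Opens) (hV : V ≤ U), x ∈ V ∧ res N hV s = res N hV t) : s = t := by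
  choose V hV hx hst using h
  exact eq_of_res_eq N (fun x : U => V x.1 x.2) (fun x => hV x.1 x.2)
    (fun x hxU => Opens.mem_iSup.mpr ⟨⟨x, hxU⟩, hx x hxU⟩) s t fun x => hst x.1 x.2

/-- Sections determined by a local property glue. -/
theorem exists_of_locally_exists (N : X.Modules) (P : ∀ V : X.Opens, Γ(N, V) → Prop)
    (hres : ∀ (V W : X.Opens) (h : W ≤ V) (s : Γ(N, V)), P V s → P W (res N h s))
    (huniq : ∀ (V : X.Opens) (s t : Γ(N, V)), P V s → P V t → s = t) {U : X.Opens}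
    (hloc : ∀ x ∈ U, ∃ V ≤ U, x ∈ V ∧ ∃ s, P V s) :
    ∃ s : Γ(N, U), ∀ x ∈ U, ∃ (V : X.Opens) (h : V ≤ U), x ∈ V ∧ P V (res N h s) := by
  choose V hV hx s hs using hloc
  obtain ⟨t, ht⟩ := exists_glue N (fun x : U => V x.1 x.2) (fun x => hV x.1 x.2)
    (fun x hxU => Opens.mem_iSup.mpr ⟨⟨x, hxU⟩, hx x hxU⟩) (fun x => s x.1 x.2)
    fun x y => huniq _ _ _ (hres _ _ _ _ (hs _ _)) (hres _ _ _ _ (hs _ _))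
  exact ⟨t, fun x hxU => ⟨V x hxU, hV x hxU, hx x hxU, (ht ⟨x, hxU⟩).symm ▸ hs x hxU⟩⟩

/-- A morphism of sheaves of modules from its components. -/
def homMk {M N : X.Modules} (f : ∀ U : X.Opens, Γ(M, U) →ₗ[Γ(X, U)] Γ(N, U))
    (hf : ∀ (U V : X.Opens) (h : V ≤ U) (s : Γ(M, U)), f V (res M h s) = res N h (f U s)) :
    M ⟶ N :=
  SheafOfModules.Hom.mk
    { app := fun U => ModuleCat.ofHom (X := M.val.obj U) (Y := N.val.obj U) (f U.unop)
      naturality := fun {U V} i => by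
        ext s
        exact hf U.unop V.unop (leOfHom i.unop) s }

theorem mono_of_injective {M N : X.Modules} (φ : M ⟶ N)
    (h : ∀ U, Function.Injective (φ.app U)) : Mono φ := by
  refine ⟨fun {K} α β hαβ => ?_⟩
  ext U s
  refine h U ?_
  exact congr(Scheme.Modules.Hom.app $hαβ U s)

theorem isIso_of_bijective {M N : X.Modules} (φ : M ⟶ N)
    (h : ∀ U, Function.Bijective (φ.app U)) : IsIso φ := by
  rw [Scheme.Modules.Hom.isIso_iff_isIso_app]
  intro U
  exact (ConcreteCategory.isIso_iff_bijective _).mpr (h U)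

/-- Sections killed by the cokernel of a monomorphism come from its source. -/
theorem exists_app_eq_of_cokernel {M N : X.Modules} (φ : M ⟶ N) [Mono φ] {U : X.Opens}
    (t : Γ(N, U)) (ht : (Limits.cokernel.π φ).app U t = 0) : ∃ s, φ.app U s = t := by
  let S : ShortComplex X.Modules := ShortComplex.mk φ (Limits.cokernel.π φ) (by simp)
  have hS : S.Exact := S.exact_of_g_is_cokernel (Limits.cokernelIsCokernel φ)
  let F : X.Modules ⥤ Ab.{u} := Scheme.Modules.toPresheaf X ⋙ (evaluation _ _).obj (op U)
  have hz : F.PreservesZeroMorphisms := ⟨fun _ _ => rfl⟩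
  have hF : (S.map F).Exact := ShortComplex.Exact.map_of_mono_of_preservesKernel hS F
    (inferInstanceAs (Mono φ)) (by
      have h1 : Limits.PreservesFiniteLimits (Scheme.Modules.toPresheaf X) := inferInstance
      have h2 : Limits.PreservesFiniteLimits
        ((evaluation X.Opensᵒᵖ Ab.{u}).obj (op U)) := inferInstance
      have h3 := Limits.comp_preservesFiniteLimits (Scheme.Modules.toPresheaf X)
        ((evaluation X.Opensᵒᵖ Ab.{u}).obj (op U))
      exact (h3.1 _).1)
  exact (ShortComplex.ab_exact_iff _).mp hF t ht

/-! ### The structure sheaf and free generators -/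

/-- Functions as sections of the structure sheaf; the identity, between types which are equal only
after unfolding. -/
def ofO (U : X.Opens) : Γ(X, U) ≃ₗ[Γ(X, U)] Γ(structureSheaf X, U) where
  toFun a := a
  invFun a := a
  left_inv _ := rfl
  right_inv _ := rfl
  map_add' _ _ := rfl
  map_smul' _ _ := rfl

theorem res_ofO {U V : X.Opens} (h : V ≤ U) (a : Γ(X, U)) :
    res (structureSheaf X) h (ofO U a) = ofO V (resO h a) := rfl

theorem ofO_symm_res {U V : X.Opens} (h : V ≤ U) (s : Γ(structureSheaf X, U)) :
    (ofO V).symm (res (structureSheaf X) h s) = resO h ((ofO U).symm s) := rfl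

theorem eq_of_locally_eqO {U : X.Opens} (a b : Γ(X, U))
    (h : ∀ x ∈ U, ∃ (V : X.Opens) (hV : V ≤ U), x ∈ V ∧ resO hV a = resO hV b) : a = b :=
  (ofO U).injective (eq_of_locally_eq _ _ _ h)

/-- The section `g` freely generates `M` over `U`: over every open `V ≤ U`, each section of `M` is a
unique multiple of `g`. -/
def IsFreeGenerator (M : X.Modules) {U : X.Opens} (g : Γ(M, U)) : Prop :=
  ∀ (V : X.Opens) (h : V ≤ U), Function.Bijective fun a : Γ(X, V) => a • res M h g

theorem IsFreeGenerator.restrict {M : X.Modules} {U V : X.Opens} {g : Γ(M, U)}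
    (hg : IsFreeGenerator M g) (h : V ≤ U) : IsFreeGenerator M (res M h g) := by
  intro W hW
  rw [res_res]
  exact hg W (hW.trans h)

/-- A section which is nowhere annihilated by a nonzero function and which generates locally is a
free generator: local coefficients are unique, hence they glue. -/
theorem isFreeGenerator_of_injective {M : X.Modules} {U : X.Opens} {g : Γ(M, U)}
    (hinj : ∀ (V : X.Opens) (h : V ≤ U), Function.Injective fun a : Γ(X, V) => a • res M h g)
    (hloc : ∀ (V : X.Opens) (h : V ≤ U) (s : Γ(M, V)), ∀ x ∈ V,
      ∃ (W : X.Opens) (hW : W ≤ V), x ∈ W ∧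
        ∃ a : Γ(X, W), a • res M (hW.trans h) g = res M hW s) : IsFreeGenerator M g := by
  refine fun V h => ⟨hinj V h, fun s => ?_⟩
  obtain ⟨c, hc⟩ := exists_of_locally_exists (structureSheaf X)
    (fun W c => ∃ hW : W ≤ V, (ofO W).symm c • res M (hW.trans h) g =
      res M hW s)
    (by
      rintro W W' h' c ⟨hW, hc⟩
      refine ⟨h'.trans hW, ?_⟩
      rw [← res_res M hW h' s, ← hc, res_smul, res_res]
      rfl)
    (by
      rintro W c c' ⟨hW, hc⟩ ⟨_, hc'⟩
      exact (ofO W).symm.injective (hinj W (hW.trans h) (hc.trans hc'.symm)))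
    (U := V) (by
      intro x hx
      obtain ⟨W, hW, hxW, a, ha⟩ := hloc V h s x hx
      refine ⟨W, hW, hxW, ofO _ a, hW, ?_⟩
      rw [← ha, LinearEquiv.symm_apply_apply])
  refine ⟨(ofO V).symm c, eq_of_locally_eq M _ _ fun x hx => ?_⟩
  obtain ⟨W, hW, hxW, _, hcW⟩ := hc x hx
  refine ⟨W, hW, hxW, ?_⟩
  rw [← hcW, res_smul, res_res]
  rfl

theorem IsFreeGenerator.of_locally {M : X.Modules} {U : X.Opens} {g : Γ(M, U)}
    (hg : ∀ x ∈ U, ∃ (V : X.Opens) (h : V ≤ U), x ∈ V ∧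
      IsFreeGenerator M (res M h g)) : IsFreeGenerator M g := by
  refine isFreeGenerator_of_injective (fun V h a b hab => eq_of_locally_eqO a b fun x hx => ?_)
    fun V h s x hx => ?_
  · obtain ⟨W, hW, hxW, hgW⟩ := hg x (h hx)
    refine ⟨V ⊓ W, inf_le_left, ⟨hx, hxW⟩, (hgW (V ⊓ W) inf_le_right).1 ?_⟩
    have := congrArg (res M (inf_le_left : V ⊓ W ≤ V)) hab
    simpa only [res_smul, res_res] using this
  · obtain ⟨W, hW, hxW, hgW⟩ := hg x (h hx)
    obtain ⟨a, ha⟩ := (hgW (V ⊓ W) inf_le_right).2 (res M inf_le_left s)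
    refine ⟨V ⊓ W, inf_le_left, ⟨hx, hxW⟩, a, ?_⟩
    rw [← ha]
    simp only [res_res]

theorem isFreeGenerator_one (U : X.Opens) : IsFreeGenerator (structureSheaf X) (ofO U 1) := by
  intro V h
  have : (fun a : Γ(X, V) => a • res (structureSheaf X) h (ofO U 1)) = ofO V := by
    funext a
    rw [res_ofO, resO, map_one, ← map_smul, smul_eq_mul, mul_one]
  rw [this]
  exact (ofO V).bijective

/-- Sections of a restriction as sections of the original sheaf; the identity, between types which
are equal only after unfolding. -/
def ofRestrict (M : X.Modules) (f : Y ⟶ X) [IsOpenImmersion f] (W : Y.Opens) :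
    Γ(M.restrict f, W) ≃+ Γ(M, f ''ᵁ W) where
  toFun s := s
  invFun s := s
  left_inv _ := rfl
  right_inv _ := rfl
  map_add' _ _ := rfl

theorem ofRestrict_smul (M : X.Modules) (f : Y ⟶ X) [IsOpenImmersion f] (W : Y.Opens)
    (a : Γ(Y, W)) (s : Γ(M.restrict f, W)) :
    ofRestrict M f W (a • s) = (f.appIso W).inv a • ofRestrict M f W s :=
  rfl

theorem ofRestrict_res (M : X.Modules) (f : Y ⟶ X) [IsOpenImmersion f] {V W : Y.Opens}
    (h : W ≤ V) (s : Γ(M.restrict f, V)) :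
    ofRestrict M f W (res (M.restrict f) h s) = res M (f.image_mono h) (ofRestrict M f V s) :=
  rfl

theorem IsFreeGenerator.of_restrict {M : X.Modules} (f : Y ⟶ X) [IsOpenImmersion f] {W : Y.Opens}
    {g : Γ(M.restrict f, W)} (hg : IsFreeGenerator _ g) :
    IsFreeGenerator M (ofRestrict M f W g) := by
  intro V hV
  obtain ⟨W', rfl⟩ : ∃ W', f ''ᵁ W' = V := by
    refine ⟨f ⁻¹ᵁ V, ?_⟩
    rw [Scheme.Hom.image_preimage_eq_opensRange_inf]
    exact inf_eq_right.mpr (hV.trans (f.image_le_opensRange W))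
  have hW : W' ≤ W := (f.image_le_image_iff W' W).mp hV
  have h2 : (fun a : Γ(X, f ''ᵁ W') => a • res M hV (ofRestrict M f W g)) =
      ofRestrict M f W' ∘ (fun a => a • res (M.restrict f) hW g) ∘ (f.appIso W').hom := by
    funext a
    simp only [Function.comp_apply]
    rw [ofRestrict_smul, CategoryTheory.Iso.hom_inv_id_apply, ofRestrict_res]
  rw [h2]
  exact (ofRestrict M f W').bijective.comp ((hg W' hW).comp
    (ConcreteCategory.bijective_of_isIso (f.appIso W').hom))

theorem IsFreeGenerator.map_iso {M N : X.Modules} (e : M ≅ N) {U : X.Opens} {g : Γ(M, U)}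
    (hg : IsFreeGenerator M g) : IsFreeGenerator N (e.hom.app U g) := by
  intro V h
  have h2 : (fun a : Γ(X, V) => a • res N h (e.hom.app U g)) =
      e.hom.app V ∘ fun a => a • res M h g := by
    funext a
    simp only [Function.comp_apply]
    rw [Scheme.Modules.Hom.app_smul, app_res]
  rw [h2]
  exact (ConcreteCategory.bijective_of_isIso (e.hom.app V)).comp (hg V h)

theorem IsInvertible.exists_isFreeGenerator {M : X.Modules} (hM : IsInvertible M) (x : X) :
    ∃ (U : X.Opens) (g : Γ(M, U)), x ∈ U ∧ IsFreeGenerator M g := by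
  obtain ⟨U, hx, ⟨e⟩⟩ := hM x
  exact ⟨U.ι ''ᵁ ⊤, _, by simpa using hx,
    ((isFreeGenerator_one (X := U) ⊤).map_iso e.symm).of_restrict U.ι⟩

theorem isInvertible_of_isFreeGenerator {M : X.Modules}
    (h : ∀ x, ∃ (U : X.Opens) (g : Γ(M, U)), x ∈ U ∧ IsFreeGenerator M g) : IsInvertible M := by
  intro x
  obtain ⟨U, g, hx, hg⟩ := h x
  have hle : ∀ V : (U : Scheme.{u}).Opens, U.ι ''ᵁ V ≤ U := fun V => by
    simpa using (U.ι.image_mono le_top : U.ι ''ᵁ V ≤ U.ι ''ᵁ ⊤)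
  let φ : structureSheaf (U : Scheme.{u}) ⟶ M.restrict U.ι := homMk
    (fun V => LinearMap.toSpanSingleton Γ((U : Scheme.{u}), V) Γ(M.restrict U.ι, V)
      ((ofRestrict M U.ι V).symm (res M (hle V) g)) ∘ₗ (ofO (X := U) V).symm.toLinearMap)
    (by
      intro V W h s
      change (ofO W).symm (res _ h s) • (ofRestrict M U.ι W).symm (res M (hle W) g) =
        res (M.restrict U.ι) h ((ofO V).symm s • (ofRestrict M U.ι V).symm (res M (hle V) g))
      rw [res_smul]
      congr 1
      exact (res_res M (hle V) (U.ι.image_mono h) g).symm)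
  have hφ : IsIso φ := isIso_of_bijective φ fun V => by
    have h2 : (φ.app V : _ → _) =
        (fun a : Γ(X, U.ι ''ᵁ V) => a • res M (hle V) g) ∘ (U.ι.appIso V).inv ∘
          (ofO (X := U) V).symm := by
      funext s
      rfl
    rw [h2]
    exact (hg _ (hle V)).comp ((ConcreteCategory.bijective_of_isIso (U.ι.appIso V).inv).comp
      (ofO (X := U) V).symm.bijective)
  exact ⟨U, hx, ⟨(asIso φ).symm⟩⟩

/-! ### Subsheaves -/

/-- A family of submodules of the sections of `M`, stable under restriction and membership in which
is a local property. -/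
structure LocalSubmodule (M : X.Modules) where
  carrier : ∀ U : X.Opens, Submodule Γ(X, U) Γ(M, U)
  res_mem : ∀ {U V : X.Opens} (h : V ≤ U) {s : Γ(M, U)}, s ∈ carrier U → res M h s ∈ carrier V
  mem_of_locally : ∀ {U : X.Opens} (s : Γ(M, U)),
    (∀ x ∈ U, ∃ (V : X.Opens) (h : V ≤ U), x ∈ V ∧ res M h s ∈ carrier V) → s ∈ carrier U

namespace LocalSubmodule

variable {M : X.Modules} (P : LocalSubmodule M)

/-- The underlying presheaf of modules. -/
def toPresheaf : PresheafOfModules.Submodule M.val where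
  obj U := P.carrier U.unop
  map := fun {_ _} i _ hs => P.res_mem (leOfHom i.unop) hs

theorem toPresheaf_isSheaf :
    TopCat.Presheaf.IsSheaf (X := X) P.toPresheaf.toPresheafOfModules.presheaf := by
  refine (TopCat.Presheaf.isSheaf_iff_isSheafUniqueGluing _).mpr fun ι U f hf => ?_
  change ∀ i, P.carrier (U i) at f
  obtain ⟨t, ht⟩ := exists_glue M U (fun i => le_iSup U i) le_rfl (fun i => (f i).1)
    fun i j => congrArg Subtype.val (hf i j)
  refine ⟨(⟨t, ?_⟩ : P.carrier (iSup U)), fun i => Subtype.ext (ht i), fun k hk => ?_⟩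
  · refine P.mem_of_locally t fun x hx => ?_
    obtain ⟨i, hi⟩ := Opens.mem_iSup.mp hx
    exact ⟨U i, le_iSup U i, hi, (ht i).symm ▸ (f i).2⟩
  · refine Subtype.ext (eq_of_res_eq M U (fun i => le_iSup U i) le_rfl _ _ fun i => ?_)
    exact (congrArg Subtype.val (hk i)).trans (ht i).symm

/-- The subsheaf whose sections are the given submodules. -/
def sheaf : X.Modules where
  val := P.toPresheaf.toPresheafOfModules
  isSheaf := P.toPresheaf_isSheaf

/-- The inclusion of the subsheaf. -/
def ι : P.sheaf ⟶ M := SheafOfModules.Hom.mk P.toPresheaf.ι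

/-- Sections of the subsheaf are the elements of the submodules. -/
def sections (U : X.Opens) : Γ(P.sheaf, U) ≃ₗ[Γ(X, U)] P.carrier U where
  toFun s := s
  invFun s := s
  left_inv _ := rfl
  right_inv _ := rfl
  map_add' _ _ := rfl
  map_smul' _ _ := rfl

theorem sections_res {U V : X.Opens} (h : V ≤ U) (s : Γ(P.sheaf, U)) :
    (P.sections V (res P.sheaf h s)).1 = res M h (P.sections U s).1 := rfl

theorem ι_injective (U : X.Opens) : Function.Injective (P.ι.app U) := fun _ _ h =>
  (P.sections U).injective (Subtype.ext h)

instance : Mono P.ι := mono_of_injective _ P.ι_injective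

/-- A subsheaf whose cokernel projection vanishes is everything. -/
theorem mem_of_cokernel_eq_zero (h : Limits.cokernel.π P.ι = 0) {U : X.Opens} (s : Γ(M, U)) :
    s ∈ P.carrier U := by
  obtain ⟨t, ht⟩ := exists_app_eq_of_cokernel P.ι s (by rw [h]; rfl)
  rw [← ht]
  exact (P.sections U t).2

end LocalSubmodule

/-! ### Duals -/

/-- Sections of `Hom(M, N)` as compatible families of linear maps; the identity, between types which
are equal only after unfolding. -/
def homSections (M N : X.Modules) (U : X.Opens) :
    Γ(sheafHom M N, U) ≃ₗ[Γ(X, U)] localHom M N U where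
  toFun s := s
  invFun s := s
  left_inv _ := rfl
  right_inv _ := rfl
  map_add' _ _ := rfl
  map_smul' _ _ := rfl

/-- The value of a section of `Hom(M, N)` over `U` on a section of `M` over `V ≤ U`. -/
def evalHom {M N : X.Modules} {U V : X.Opens} (α : Γ(sheafHom M N, U)) (h : V ≤ U) :
    Γ(M, V) →ₗ[Γ(X, V)] Γ(N, V) :=
  (homSections M N U α).1 ⟨V, h⟩

section evalHom

variable {M N : X.Modules} {U V W : X.Opens}

theorem evalHom_res (α : Γ(sheafHom M N, U)) (hV : V ≤ U) (hW : W ≤ V) (s : Γ(M, W)) :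
    evalHom (res (sheafHom M N) hV α) hW s = evalHom α (hW.trans hV) s := rfl

theorem evalHom_smul (a : Γ(X, U)) (α : Γ(sheafHom M N, U)) (hV : V ≤ U) (s : Γ(M, V)) :
    evalHom (a • α) hV s = resO hV a • evalHom α hV s := rfl

theorem evalHom_add (α β : Γ(sheafHom M N, U)) (hV : V ≤ U) (s : Γ(M, V)) :
    evalHom (α + β) hV s = evalHom α hV s + evalHom β hV s := rfl

theorem res_evalHom (α : Γ(sheafHom M N, U)) (hV : V ≤ U) (hW : W ≤ V) (s : Γ(M, V)) :
    res N hW (evalHom α hV s) = evalHom α (hW.trans hV) (res M hW s) :=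
  (homSections M N U α).2 ⟨V, hV⟩ ⟨W, hW.trans hV⟩ hW s

theorem evalHom_ext {α β : Γ(sheafHom M N, U)}
    (h : ∀ (V : X.Opens) (hV : V ≤ U) (s : Γ(M, V)), evalHom α hV s = evalHom β hV s) : α = β :=
  (homSections M N U).injective (Subtype.ext (funext fun V => LinearMap.ext fun s => h V.1 V.2 s))

/-- A section of `Hom(M, N)` from compatible linear maps. -/
def mkHom (f : ∀ V : X.Opens, V ≤ U → (Γ(M, V) →ₗ[Γ(X, V)] Γ(N, V)))
    (hf : ∀ (V W : X.Opens) (hV : V ≤ U) (hW : W ≤ V) (s : Γ(M, V)),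
      res N hW (f V hV s) = f W (hW.trans hV) (res M hW s)) : Γ(sheafHom M N, U) :=
  (homSections M N U).symm ⟨fun V => f V.1 V.2, fun V W h s => hf V.1 W.1 V.2 h s⟩

/-- Sections of `Hom(M, N)` are determined by their value on a generator of `M`. -/
theorem IsFreeGenerator.eq_of_evalHom_eq {g : Γ(M, U)} (hg : IsFreeGenerator M g)
    {α β : Γ(sheafHom M N, U)} (h : evalHom α le_rfl g = evalHom β le_rfl g) : α = β := by
  refine evalHom_ext fun V hV s => ?_
  obtain ⟨a, rfl⟩ := (hg V hV).2 s
  change evalHom α hV (a • res M hV g) = evalHom β hV (a • res M hV g)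
  rw [map_smul, map_smul, ← res_evalHom α le_rfl, ← res_evalHom β le_rfl, h]

/-- The dual generator of a free generator. -/
theorem IsFreeGenerator.exists_dual {g : Γ(M, U)} (hg : IsFreeGenerator M g) :
    ∃ ℓ : Γ(sheafHom M (structureSheaf X), U), IsFreeGenerator _ ℓ := by
  let e : ∀ V : X.Opens, V ≤ U → (Γ(X, V) ≃ₗ[Γ(X, V)] Γ(M, V)) := fun V hV =>
    LinearEquiv.ofBijective (LinearMap.toSpanSingleton _ _ (res M hV g)) (hg V hV)
  have he : ∀ (V : X.Opens) (hV : V ≤ U) a, e V hV a = a • res M hV g := fun _ _ _ => rfl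
  let ℓ : Γ(sheafHom M (structureSheaf X), U) :=
    mkHom (fun V hV => (ofO V).toLinearMap ∘ₗ (e V hV).symm.toLinearMap) (by
      intro V W hV hW s
      obtain ⟨a, rfl⟩ := (e V hV).surjective s
      have : res M hW (e V hV a) = e W (hW.trans hV) (resO hW a) := by
        rw [he, he, res_smul, res_res]
      rw [this]
      simp [res_ofO])
  have hℓ : ∀ (V : X.Opens) (hV : V ≤ U), evalHom ℓ hV (res M hV g) = ofO V 1 := by
    intro V hV
    have : res M hV g = e V hV 1 := by rw [he, one_smul]
    change ofO V ((e V hV).symm _) = _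
    rw [this, LinearEquiv.symm_apply_apply]
  refine ⟨ℓ, fun V hV => ⟨fun a b hab => ?_, fun α => ?_⟩⟩
  · have := congrArg (fun α => evalHom α le_rfl (res M hV g)) hab
    simp only [evalHom_smul, evalHom_res, hℓ, resO_self, ← map_smul, smul_eq_mul, mul_one] at this
    exact (ofO V).injective this
  · refine ⟨(ofO V).symm (evalHom α le_rfl (res M hV g)), evalHom_ext fun W hW s => ?_⟩
    obtain ⟨a, rfl⟩ := (e W (hW.trans hV)).surjective s
    rw [he, map_smul, map_smul, evalHom_smul, evalHom_res, hℓ, ← res_res M hV hW,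
      ← res_evalHom α le_rfl hW, ← ofO_symm_res, ← map_smul, smul_eq_mul, mul_one,
      LinearEquiv.apply_symm_apply]

end evalHom

end

end CurveSheaf

/-! ### Germs and generators -/

namespace CurveSheaf

noncomputable section

variable {X Y : Scheme.{u}}

/-- The germ of a section of a sheaf of modules. -/
abbrev germ (M : X.Modules) {U : X.Opens} (x : X) (hx : x ∈ U) (s : Γ(M, U)) :
    M.presheaf.stalk x :=
  M.presheaf.germ U x hx s

theorem germ_res (M : X.Modules) {U V : X.Opens} (h : V ≤ U) (x : X) (hx : x ∈ V) (s : Γ(M, U)) :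
    germ M x hx (res M h s) = germ M x (h hx) s :=
  TopCat.Presheaf.germ_res_apply M.presheaf (homOfLE h) x hx s

theorem germ_resO {U V : X.Opens} (h : V ≤ U) (x : X) (hx : x ∈ V) (a : Γ(X, U)) :
    X.presheaf.germ V x hx (resO h a) = X.presheaf.germ U x (h hx) a :=
  TopCat.Presheaf.germ_res_apply X.presheaf (homOfLE h) x hx a

theorem germ_eq_iff (M : X.Modules) {U : X.Opens} {x : X} (hx : x ∈ U) (s t : Γ(M, U)) :
    germ M x hx s = germ M x hx t ↔
      ∃ (V : X.Opens) (h : V ≤ U), x ∈ V ∧ res M h s = res M h t := by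
  constructor
  · intro h
    obtain ⟨V, hxV, i, j, hV⟩ := TopCat.Presheaf.germ_eq M.presheaf x hx hx s t h
    exact ⟨V, leOfHom i, hxV, hV⟩
  · rintro ⟨V, h, hxV, hV⟩
    rw [← germ_res M h x hxV s, hV, germ_res]

theorem germO_eq_iff {U : X.Opens} {x : X} (hx : x ∈ U) (a b : Γ(X, U)) :
    X.presheaf.germ U x hx a = X.presheaf.germ U x hx b ↔
      ∃ (V : X.Opens) (h : V ≤ U), x ∈ V ∧ resO h a = resO h b := by
  constructor
  · intro h
    obtain ⟨V, hxV, i, j, hV⟩ := TopCat.Presheaf.germ_eq X.presheaf x hx hx a b h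
    exact ⟨V, leOfHom i, hxV, hV⟩
  · rintro ⟨V, h, hxV, hV⟩
    rw [← germ_resO h x hxV a, hV, germ_resO]

theorem germ_eq_zero_iff (M : X.Modules) {U : X.Opens} {x : X} (hx : x ∈ U) (s : Γ(M, U)) :
    germ M x hx s = 0 ↔ ∃ (V : X.Opens) (h : V ≤ U), x ∈ V ∧ res M h s = 0 := by
  have := germ_eq_iff M hx s 0
  simp only [germ, map_zero, res] at this
  exact this

theorem exists_isUnit_resO {U : X.Opens} {x : X} (hx : x ∈ U) {a : Γ(X, U)}
    (ha : IsUnit (X.presheaf.germ U x hx a)) :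
    ∃ (V : X.Opens) (h : V ≤ U), x ∈ V ∧ IsUnit (resO h a) :=
  ⟨X.basicOpen a, X.basicOpen_le a, (X.mem_basicOpen a x hx).mpr ha,
    RingedSpace.isUnit_res_basicOpen _ a⟩

theorem IsFreeGenerator.isUnit_smul {M : X.Modules} {U : X.Opens} {g : Γ(M, U)}
    (hg : IsFreeGenerator M g) {a : Γ(X, U)} (ha : IsUnit a) : IsFreeGenerator M (a • g) := by
  intro V h
  have hu : IsUnit (resO h a) := ha.map (X.presheaf.map (homOfLE h).op).hom
  have : (fun c : Γ(X, V) => c • res M h (a • g)) =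
      (fun c => c • res M h g) ∘ fun c => c * resO h a := by
    funext c
    simp only [Function.comp_apply]
    rw [res_smul, mul_smul]
  rw [this]
  exact (hg V h).comp hu.unit.mulRight_bijective

/-- The submodule `𝔪_x M_x` of the stalk of `M` at `x`. -/
def maxStalk (M : X.Modules) (x : X) : Submodule (X.presheaf.stalk x) (M.presheaf.stalk x) :=
  IsLocalRing.maximalIdeal (X.presheaf.stalk x) • ⊤

/-- Nakayama's lemma: the germs of a free generator do not lie in `𝔪_x M_x`. -/
theorem IsFreeGenerator.germ_notMem {M : X.Modules} {U : X.Opens} {g : Γ(M, U)}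
    (hg : IsFreeGenerator M g) {x : X} (hx : x ∈ U) : germ M x hx g ∉ maxStalk M x := by
  have hgen : ∀ q : M.presheaf.stalk x, ∃ a : X.presheaf.stalk x, q = a • germ M x hx g := by
    intro q
    obtain ⟨V, hVU, hxV, s, rfl⟩ := TopCat.Presheaf.exists_le_germ_eq M.presheaf q hx
    obtain ⟨a, rfl⟩ := (hg V hVU).2 s
    refine ⟨X.presheaf.germ V x hxV a, ?_⟩
    rw [← germ_res M hVU x hxV g]
    exact germ_smul M x V hxV a _
  intro hmem
  obtain ⟨m, hm, hmg⟩ : ∃ m ∈ IsLocalRing.maximalIdeal (X.presheaf.stalk x),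
      germ M x hx g = m • germ M x hx g := by
    refine Submodule.smul_induction_on (p := fun q => ∃ m ∈ IsLocalRing.maximalIdeal
      (X.presheaf.stalk x), q = m • germ M x hx g) hmem ?_ ?_
    · intro r hr q _
      obtain ⟨a, rfl⟩ := hgen q
      exact ⟨r * a, Ideal.mul_mem_right _ _ hr, by rw [mul_smul]⟩
    · rintro _ _ ⟨m, hm, rfl⟩ ⟨m', hm', rfl⟩
      exact ⟨m + m', Ideal.add_mem _ hm hm', by rw [add_smul]⟩
  have hu : IsUnit (1 - m) := IsLocalRing.isUnit_one_sub_self_of_mem_nonunits m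
    ((IsLocalRing.mem_maximalIdeal m).mp hm)
  have h0 : germ M x hx g = 0 := by
    refine hu.smul_left_cancel.mp ?_
    rw [smul_zero, sub_smul, one_smul, ← hmg, sub_self]
  obtain ⟨V, hV, hxV, hgV⟩ := (germ_eq_zero_iff M hx g).mp h0
  have h10 : (1 : Γ(X, V)) = 0 := (hg V hV).1 (by simp [hgV])
  have := congrArg (X.presheaf.germ V x hxV) h10
  rw [map_one, map_zero] at this
  exact one_ne_zero this

/-- In a sheaf which is free of rank one near `x`, a section with germ outside `𝔪_x M_x` is a free
generator near `x`. -/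
theorem IsFreeGenerator.exists_of_germ_notMem {M : X.Modules} {U V : X.Opens} {e : Γ(M, U)}
    (he : IsFreeGenerator M e) {x : X} (hx : x ∈ U) {s : Γ(M, V)} (hxV : x ∈ V)
    (hs : germ M x hxV s ∉ maxStalk M x) :
    ∃ (W : X.Opens) (h : W ≤ V), x ∈ W ∧ IsFreeGenerator M (res M h s) := by
  obtain ⟨c, hc⟩ := (he (V ⊓ U) inf_le_right).2 (res M inf_le_left s)
  have hxI : x ∈ V ⊓ U := ⟨hxV, hx⟩
  have hu : IsUnit (X.presheaf.germ (V ⊓ U) x hxI c) := by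
    by_contra hcon
    refine hs ?_
    have hc' : c • res M inf_le_right e = res M inf_le_left s := hc
    rw [← germ_res M (inf_le_left : V ⊓ U ≤ V) x hxI s, ← hc']
    have h3 : germ M x hxI (c • res M inf_le_right e) =
      X.presheaf.germ _ x hxI c • germ M x hxI (res M inf_le_right e) := germ_smul M x _ hxI c _
    rw [h3]
    exact Submodule.smul_mem_smul ((IsLocalRing.mem_maximalIdeal _).mpr hcon) trivial
  obtain ⟨W, hW, hxW, hcW⟩ := exists_isUnit_resO hxI hu
  refine ⟨W, hW.trans inf_le_left, hxW, ?_⟩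
  rw [← res_res M inf_le_left hW s, ← hc, res_smul, res_res]
  exact (he.restrict _).isUnit_smul hcW

/-- The sections of `M` whose germ at `y` lies in `𝔪_y M_y`. -/
def maxSubmodule (M : X.Modules) (y : X) : LocalSubmodule M where
  carrier U :=
    { carrier := {s | ∀ hy : y ∈ U, germ M y hy s ∈ maxStalk M y}
      zero_mem' := fun hy => by simp [germ]
      add_mem' := fun hs ht hy => by
        simp only [germ, map_add]
        exact add_mem (hs hy) (ht hy)
      smul_mem' := fun a s hs hy => by
        simp only [germ]
        rw [germ_smul]
        exact Submodule.smul_mem _ _ (hs hy) }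
  res_mem := fun h s hs hy => by
    rw [germ_res]
    exact hs (h hy)
  mem_of_locally := fun s hs hy => by
    obtain ⟨V, h, hyV, hV⟩ := hs y hy
    rw [← germ_res M h y hyV s]
    exact hV hyV

/-! ### The pullback modulo torsion -/

/-- Morphisms preserve torsion sections. -/
theorem app_mem_torsionSections {M N : X.Modules} (φ : M ⟶ N) {U : X.Opens}
    {s : Γ(M, U)} (hs : s ∈ torsionSections M U) : φ.app U s ∈ torsionSections N U := by
  intro x hx hgen
  obtain ⟨V, h, hxV, hV⟩ := (germ_eq_zero_iff M hx s).mp (hs x hx hgen)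
  exact (germ_eq_zero_iff N hx _).mpr ⟨V, h, hxV, by rw [← app_res, hV, map_zero]⟩

variable (b : Y ⟶ X) (J : X.Modules)

/-- The projection from `b^* J` to `J^b`. -/
def toModTorsion : (Scheme.Modules.pullback b).obj J ⟶ pullbackModTorsion b J :=
  Limits.cokernel.π (torsionι ((Scheme.Modules.pullback b).obj J))

instance : Epi (toModTorsion b J) :=
  inferInstanceAs (Epi (Limits.cokernel.π (torsionι ((Scheme.Modules.pullback b).obj J))))

/-- The canonical morphism from `J` to the direct image of `J^b`. -/
def toPullbackModTorsion : J ⟶ (Scheme.Modules.pushforward b).obj (pullbackModTorsion b J) :=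
  (Scheme.Modules.pullbackPushforwardAdjunction b).unit.app J ≫
    (Scheme.Modules.pushforward b).map (toModTorsion b J)

/-- The pullback of sections of `J` to sections of `J^b`. -/
def pullSection (U : X.Opens) : Γ(J, U) →+ Γ(pullbackModTorsion b J, b ⁻¹ᵁ U) :=
  ((toPullbackModTorsion b J).app U).hom

theorem pullSection_smul {U : X.Opens} (a : Γ(X, U)) (s : Γ(J, U)) :
    pullSection b J U (a • s) = b.app U a • pullSection b J U s :=
  (toPullbackModTorsion b J).app_smul a s

theorem pullSection_res {U V : X.Opens} (h : V ≤ U) (s : Γ(J, U)) :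
    pullSection b J V (res J h s) =
      res (pullbackModTorsion b J) (b.preimage_mono h) (pullSection b J U s) :=
  app_res (toPullbackModTorsion b J) h s

/-- Morphisms out of `J^b` are determined by their values on sections of `J`. -/
theorem eq_zero_of_pullSection {K : Y.Modules} (π : pullbackModTorsion b J ⟶ K)
    (h : ∀ (U : X.Opens) (s : Γ(J, U)), π.app (b ⁻¹ᵁ U) (pullSection b J U s) = 0) : π = 0 := by
  rw [← cancel_epi (toModTorsion b J)]
  apply ((Scheme.Modules.pullbackPushforwardAdjunction b).homEquiv _ _).injective
  rw [Limits.comp_zero, Adjunction.homEquiv_unit, Adjunction.homEquiv_unit, Functor.map_zero,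
    Limits.comp_zero, Functor.map_comp]
  ext U s
  exact h U s

/-- A morphism from `J` to the direct image of a torsion-free sheaf factors through `J^b`. -/
theorem exists_factor {K : Y.Modules} (hK : ∀ U, torsionSections K U = ⊥)
    (f : J ⟶ (Scheme.Modules.pushforward b).obj K) :
    ∃ π : pullbackModTorsion b J ⟶ K, ∀ (U : X.Opens) (s : Γ(J, U)),
      π.app (b ⁻¹ᵁ U) (pullSection b J U s) = f.app U s := by
  let adj := Scheme.Modules.pullbackPushforwardAdjunction b
  let f' := (adj.homEquiv J K).symm f
  have hf' : torsionι _ ≫ f' = 0 := by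
    ext U s
    have hs : (torsionι _).app U s ∈ torsionSections ((Scheme.Modules.pullback b).obj J) U := s.2
    have := app_mem_torsionSections f' hs
    rw [hK U] at this
    exact this
  let π : pullbackModTorsion b J ⟶ K := Limits.cokernel.desc _ f' hf'
  have hπ : toModTorsion b J ≫ π = f' := Limits.cokernel.π_desc _ f' hf'
  refine ⟨π, fun U s => ?_⟩
  have h1 : toPullbackModTorsion b J ≫ (Scheme.Modules.pushforward b).map π = f := by
    rw [toPullbackModTorsion, Category.assoc, ← Functor.map_comp, hπ, ← Adjunction.homEquiv_unit]
    exact (adj.homEquiv J K).apply_symm_apply f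
  exact congr(Scheme.Modules.Hom.app $h1 U s)

/-- Let `i` be a section of `b` over an open subset containing the generic points. Then a
torsion-free sheaf `J` embeds into the direct image of `J^b`: the restriction of `J` to that open
subset, pushed forward along `i`, is torsion-free, so that `J^b` maps to it, and `J` embeds into
its direct image. -/
theorem pullSection_injective {Z : Scheme.{u}} (i : Z ⟶ Y) [IsOpenImmersion (i ≫ b)]
    (hX : ∀ η ∈ genericPoints X, ∃ z, (i ≫ b) z = η)
    (hY : ∀ z, (i ≫ b) z ∈ genericPoints X → i z ∈ genericPoints Y)
    (hJ : ∀ U, torsionSections J U = ⊥) (U : X.Opens) :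
    Function.Injective (pullSection b J U) := by
  let K : Y.Modules := (Scheme.Modules.pushforward i).obj (J.restrict (i ≫ b))
  have hle : ∀ V : X.Opens, (i ≫ b) ''ᵁ (i ≫ b) ⁻¹ᵁ V ≤ V := fun V => (i ≫ b).image_preimage_le V
  let f : J ⟶ (Scheme.Modules.pushforward b).obj K :=
    (Scheme.Modules.restrictAdjunction (i ≫ b)).unit.app J ≫
      (Scheme.Modules.pushforwardComp i b).inv.app _
  have hf : ∀ V s, f.app V s = res J (hle V) s := fun V s => rfl
  have hK : ∀ W, torsionSections K W = ⊥ := by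
    intro W
    rw [eq_bot_iff]
    intro n hn
    let n' : Γ(J, (i ≫ b) ''ᵁ i ⁻¹ᵁ W) := n
    have hn' : n' ∈ torsionSections J ((i ≫ b) ''ᵁ i ⁻¹ᵁ W) := by
      rintro _ ⟨z, hz, rfl⟩ hgen
      obtain ⟨W', h, hzW', hW'⟩ := (germ_eq_zero_iff K hz n).mp (hn (i z) hz (hY z hgen))
      exact (germ_eq_zero_iff J _ n').mpr ⟨(i ≫ b) ''ᵁ i ⁻¹ᵁ W',
        (i ≫ b).image_mono (i.preimage_mono h), ⟨z, hzW', rfl⟩, hW'⟩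
    rw [hJ] at hn'
    exact hn'
  obtain ⟨π, hπ⟩ := exists_factor b J hK f
  rw [injective_iff_map_eq_zero]
  intro s hs
  have h0 : res J (hle U) s = 0 := by
    rw [← hf, ← hπ, hs, map_zero]
    rfl
  have hmem : s ∈ torsionSections J U := by
    intro η hη hgen
    obtain ⟨z, rfl⟩ := hX η hgen
    exact (germ_eq_zero_iff J hη s).mpr ⟨_, hle U, ⟨z, hη, rfl⟩, h0⟩
  rw [hJ] at hmem
  exact hmem

/-- If a reduced scheme has an open subset containing its generic points over which `b` has a
section, functions are determined by their pullback along `b`. -/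
theorem app_injective [IsReduced X] {Z : Scheme.{u}} (i : Z ⟶ Y) [IsOpenImmersion (i ≫ b)]
    (hX : ∀ η ∈ genericPoints X, ∃ z, (i ≫ b) z = η) (U : X.Opens) :
    Function.Injective (b.app U) := by
  rw [injective_iff_map_eq_zero]
  intro a ha
  have h0 : resO ((i ≫ b).image_preimage_le U) a = 0 := by
    have h1 := congr($((i ≫ b).app_appIso_inv U) a)
    have h2 : (i ≫ b).app U a = 0 := by
      rw [Scheme.Hom.comp_app]
      exact (congrArg (i.app _) ha).trans (map_zero _)
    exact h1.symm.trans ((congrArg ((i ≫ b).appIso _).inv h2).trans (map_zero _))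
  refine eq_zero_of_genericPoints a fun η hη hgen => ?_
  obtain ⟨z, rfl⟩ := hX η hgen
  exact (germ_resO ((i ≫ b).image_preimage_le U) _ ⟨z, hη, rfl⟩ a).symm.trans
    (by rw [h0, map_zero]; rfl)

/-! ### Sections of `J` generating `J^b` -/

variable {b J}

/-- The germs of pulled back sections of `J` do not all vanish in the fibre of `J^b` at `y`.
Otherwise they all belong to the subsheaf of sections vanishing in that fibre, hence so do all
sections of `J^b`. -/
theorem exists_pullSection_germ_notMem (hQ : IsInvertible (pullbackModTorsion b J)) (y : Y) :
    ∃ (U : X.Opens) (hy : y ∈ b ⁻¹ᵁ U) (h : Γ(J, U)),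
      germ _ y hy (pullSection b J U h) ∉ maxStalk (pullbackModTorsion b J) y := by
  by_contra! hcon
  obtain ⟨W, e, hyW, he⟩ := hQ.exists_isFreeGenerator y
  let P := maxSubmodule (pullbackModTorsion b J) y
  have hP : Limits.cokernel.π P.ι = 0 := by
    refine eq_zero_of_pullSection b J _ fun U s => ?_
    have hs : pullSection b J U s ∈ P.carrier (b ⁻¹ᵁ U) := fun hy => hcon U hy s
    have h1 := congr(Scheme.Modules.Hom.app $(Limits.cokernel.condition P.ι) (b ⁻¹ᵁ U)
      ((P.sections _).symm ⟨_, hs⟩))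
    exact h1
  exact he.germ_notMem hyW (P.mem_of_cokernel_eq_zero hP e hyW)

/-- If the fibre of a closed morphism `b` over `x` is finite and `J^b` is invertible, a suitable
section of `J` near `x` generates `J^b`. -/
theorem exists_isFreeGenerator_pullSection {k : Type*} [Field k] [Infinite k] (σ : k →+* Γ(X, ⊤))
    (hb : IsClosedMap b) (hQ : IsInvertible (pullbackModTorsion b J)) (x : X)
    (hfin : (b ⁻¹' {x}).Finite) :
    ∃ (U : X.Opens) (h : Γ(J, U)), x ∈ U ∧
      IsFreeGenerator (pullbackModTorsion b J) (pullSection b J U h) := by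
  let Q := pullbackModTorsion b J
  choose V hV h hh using fun y => exists_pullSection_germ_notMem (b := b) (J := J) hQ y
  let U : X.Opens := ⟨⋂ y ∈ b ⁻¹' {x}, V y, hfin.isOpen_biInter fun y _ => (V y).isOpen⟩
  have hxU : x ∈ U := by
    refine Set.mem_iInter₂.mpr fun y hy => ?_
    have : b y ∈ V y := hV y
    rwa [show b y = x from hy] at this
  have hUV : ∀ y, b y = x → U ≤ V y := fun y hy => Set.biInter_subset_of_mem hy
  -- The sections that fail to generate `J^b` at `y`.
  let B : Y → Submodule Γ(X, U) Γ(J, U) := fun y =>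
    { carrier := {s | ∀ hy : y ∈ b ⁻¹ᵁ U,
        germ Q y hy (pullSection b J U s) ∈ maxStalk Q y}
      zero_mem' := fun hy => by simp [germ]
      add_mem' := fun hs ht hy => by
        simp only [germ, map_add]
        exact add_mem (hs hy) (ht hy)
      smul_mem' := fun a s hs hy => by
        simp only [germ]
        rw [pullSection_smul, germ_smul]
        exact Submodule.smul_mem _ _ (hs hy) }
  obtain ⟨g, hg⟩ : ∃ g : Γ(J, U), ∀ y, b y = x → g ∉ B y := by
    let _ : Algebra k Γ(X, U) := ((X.presheaf.map (homOfLE le_top).op).hom.comp σ).toAlgebra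
    let _ : Module k Γ(J, U) := Module.compHom _ (algebraMap k Γ(X, U))
    have : IsScalarTower k Γ(X, U) Γ(J, U) := .of_algebraMap_smul fun _ _ => rfl
    classical
    let S : Finset (Subspace k Γ(J, U)) :=
      hfin.toFinset.image fun y => (B y).restrictScalars k
    have hS : ⊤ ∉ S := by
      intro hmem
      obtain ⟨y, hy, hBy⟩ := Finset.mem_image.mp hmem
      have hy' : b y = x := by simpa using hy
      have hin : res J (hUV y hy') (h y) ∈ (B y).restrictScalars k := hBy ▸ Submodule.mem_top
      have hyU : b y ∈ U := hy' ▸ hxU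
      have hyU' : y ∈ b ⁻¹ᵁ U := hyU
      have := hin hyU'
      rw [pullSection_res, germ_res] at this
      exact hh y this
    -- A vector space over an infinite field is not a finite union of proper subspaces.
    have hne := Subspace.biUnion_ne_univ_of_top_notMem hS
    obtain ⟨g, hg⟩ := (Set.ne_univ_iff_exists_notMem _).mp hne
    refine ⟨g, fun y hy hgy => hg ?_⟩
    refine Set.mem_iUnion₂.mpr ⟨(B y).restrictScalars k, ?_, hgy⟩
    exact Finset.mem_image.mpr ⟨y, by simpa using hy, rfl⟩
  -- The locus where `g` generates `J^b` is open and contains the fibre over `x`.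
  let G : Set Y := ⋃ W ∈ {W : Y.Opens | ∃ hW : W ≤ b ⁻¹ᵁ U,
    IsFreeGenerator Q (res Q hW (pullSection b J U g))}, (W : Set Y)
  have hG : IsOpen G := isOpen_biUnion fun W _ => W.isOpen
  have hfG : ∀ y, b y = x → y ∈ G := by
    intro y hy
    obtain ⟨W, e, hyW, he⟩ := hQ.exists_isFreeGenerator y
    have hyU : b y ∈ U := hy ▸ hxU
    have hg' : germ Q (U := b ⁻¹ᵁ U) y hyU (pullSection b J U g) ∉ maxStalk Q y :=
      fun hmem => hg y hy fun _ => hmem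
    obtain ⟨W', hW', hyW', hfree⟩ := he.exists_of_germ_notMem hyW (V := b ⁻¹ᵁ U) hyU hg'
    exact Set.mem_iUnion₂.mpr ⟨W', ⟨hW', hfree⟩, hyW'⟩
  let U' : X.Opens := ⟨U ∩ (b '' Gᶜ)ᶜ, U.isOpen.inter (hb _ hG.isClosed_compl).isOpen_compl⟩
  have hU' : U' ≤ U := Set.inter_subset_left
  refine ⟨U', res J hU' g, ⟨hxU, ?_⟩, .of_locally fun y hy => ?_⟩
  · rintro ⟨y, hy, hyx⟩
    exact hy (hfG y hyx)
  · have hyG : y ∈ G := by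
      by_contra hcon
      exact hy.2 ⟨y, hcon, rfl⟩
    obtain ⟨W, ⟨hW, hfree⟩, hyW⟩ := Set.mem_iUnion₂.mp hyG
    refine ⟨b ⁻¹ᵁ U' ⊓ W, inf_le_left, ⟨hy, hyW⟩, ?_⟩
    rw [pullSection_res, res_res]
    have := hfree.restrict (inf_le_right : b ⁻¹ᵁ U' ⊓ W ≤ W)
    rwa [res_res] at this

end

end CurveSheaf

/-! ### Quasi-coherent sheaves on affine open subsets -/

namespace CurveSheaf

noncomputable section

variable {X Y : Scheme.{u}}

theorem image_fromSpec_le {V : X.Opens} (hV : IsAffineOpen V) (W : (Spec Γ(X, V)).Opens) :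
    hV.fromSpec ''ᵁ W ≤ V := by
  refine ((hV.fromSpec).image_mono le_top).trans ?_
  rw [Scheme.Hom.image_top_eq_opensRange, hV.opensRange_fromSpec]

/-- The two actions of `Γ(X, V)` on the sections of `M`, through the affine scheme `Spec Γ(X, V)`
and through restriction in `X`, agree. -/
theorem ofRestrict_fromSpec_smul {V : X.Opens} (hV : IsAffineOpen V) (M : X.Modules)
    (W : (Spec Γ(X, V)).Opens) (a : Γ(X, V)) (s : Γ(M.restrict hV.fromSpec, W)) :
    ofRestrict M hV.fromSpec W (a • s) =
      resO (image_fromSpec_le hV W) a • ofRestrict M hV.fromSpec W s := by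
  rw [Scheme.Modules.smul_Spec_def, ofRestrict_smul]
  congr 1
  have h1 := hV.fromSpec_app_of_le V le_rfl
  have h2 := hV.fromSpec.app_appIso_inv V
  have h3 : (Scheme.ΓSpecIso Γ(X, V)).inv ≫ (Spec Γ(X, V)).presheaf.map W.leTop.op ≫
      (hV.fromSpec.appIso W).inv = X.presheaf.map (homOfLE (image_fromSpec_le hV W)).op := by
    have hW : W ≤ hV.fromSpec ⁻¹ᵁ V := by rw [hV.fromSpec_preimage_self]; exact le_top
    have h4 := hV.fromSpec.appIso_inv_naturality (homOfLE hW).op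
    have h5 : (Scheme.ΓSpecIso Γ(X, V)).inv ≫ (Spec Γ(X, V)).presheaf.map W.leTop.op =
        hV.fromSpec.app V ≫ (Spec Γ(X, V)).presheaf.map (homOfLE hW).op := by
      rw [h1]
      simp only [Category.assoc, ← Functor.map_comp]
      simp
      rfl
    rw [reassoc_of% h5, h4, reassoc_of% h2]
    exact (X.presheaf.map_comp _ _).symm
  exact congr($h3 a)

theorem isLocalizing_restrict_fromSpec {V : X.Opens} (hV : IsAffineOpen V) (M : X.Modules)
    [M.IsQuasicoherent] : IsLocalizing (modulesSpecToSheaf.obj (M.restrict hV.fromSpec)) := by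
  have : (M.restrict hV.fromSpec).IsQuasicoherent :=
    Scheme.Modules.isQuasicoherent_restrictFunctor hV.fromSpec M
  exact (isIso_fromTildeΓ_iff_isLocalizing _).mp
    (Scheme.Modules.isIso_fromTildeΓ_of_isQuasicoherent _)

theorem image_fromSpec_basicOpen_eq {V : X.Opens} (hV : IsAffineOpen V) (f : Γ(X, V))
    {D : (Spec Γ(X, V)).Opens} (hD : D = PrimeSpectrum.basicOpen f) :
    hV.fromSpec ''ᵁ D = X.basicOpen f :=
  hD ▸ hV.fromSpec_image_basicOpen f

theorem _root_.AlgebraicGeometry.IsLocalizing.exists_smul_eq_zero {R : CommRingCat.{u}}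
    {N : (Spec R).Modules}
    (hN : IsLocalizing (modulesSpecToSheaf.obj N)) (f : R) {D : (Spec R).Opens}
    (hD : D = PrimeSpectrum.basicOpen f) (s : Γ(N, ⊤))
    (hs : res N (le_top : D ≤ ⊤) s = 0) : ∃ n : ℕ, f ^ n • s = 0 := by
  subst hD
  have := hN f
  obtain ⟨⟨_, n, rfl⟩, hn⟩ := (IsLocalizedModule.eq_zero_iff (.powers f)
    ((modulesSpecToSheaf.obj N).obj.map (PrimeSpectrum.basicOpen f).leTop.op).hom).mp hs
  exact ⟨n, hn⟩

theorem _root_.AlgebraicGeometry.IsLocalizing.exists_res_eq_smul {R : CommRingCat.{u}}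
    {N : (Spec R).Modules}
    (hN : IsLocalizing (modulesSpecToSheaf.obj N)) (f : R) {D : (Spec R).Opens}
    (hD : D = PrimeSpectrum.basicOpen f) (t : Γ(N, D)) :
    ∃ (n : ℕ) (s : Γ(N, ⊤)), res N (le_top : D ≤ ⊤) s = f ^ n • t := by
  subst hD
  have := hN f
  have h := IsLocalizedModule.surj (.powers f)
    ((modulesSpecToSheaf.obj N).obj.map (PrimeSpectrum.basicOpen f).leTop.op).hom
  obtain ⟨⟨s, ⟨_, n, rfl⟩⟩, hn⟩ := h t
  exact ⟨n, s, hn.symm⟩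

/-- A section of a quasi-coherent sheaf over an affine open subset which vanishes where `f` is
invertible is annihilated by a power of `f`. -/
theorem exists_pow_smul_eq_zero {V : X.Opens} (hV : IsAffineOpen V) (M : X.Modules)
    [M.IsQuasicoherent] (f : Γ(X, V)) (s : Γ(M, V)) (hs : res M (X.basicOpen_le f) s = 0) :
    ∃ n : ℕ, f ^ n • s = 0 := by
  let j := hV.fromSpec
  have hle := image_fromSpec_le hV
  let D : (Spec Γ(X, V)).Opens := PrimeSpectrum.basicOpen f
  have hD : j ''ᵁ D = X.basicOpen f := image_fromSpec_basicOpen_eq hV f rfl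
  let s' : Γ(M.restrict j, ⊤) := (ofRestrict M j ⊤).symm (res M (hle ⊤) s)
  have hs' : res (M.restrict j) (le_top : D ≤ ⊤) s' = 0 := by
    apply (ofRestrict M j D).injective
    rw [ofRestrict_res, AddEquiv.apply_symm_apply, res_res, map_zero,
      ← res_res M (X.basicOpen_le f) hD.le, hs, res_zero]
  obtain ⟨n, hn⟩ := (isLocalizing_restrict_fromSpec hV M).exists_smul_eq_zero f rfl s' hs'
  refine ⟨n, ?_⟩
  have h1 := congrArg (ofRestrict M j ⊤) hn
  have h2 : resO (hle ⊤) (f ^ n) • res M (hle ⊤) s = 0 :=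
    (ofRestrict_fromSpec_smul hV M ⊤ (f ^ n) s').symm.trans h1
  rw [← res_smul] at h2
  have hV' : V ≤ j ''ᵁ ⊤ := by
    rw [Scheme.Hom.image_top_eq_opensRange, hV.opensRange_fromSpec]
  have h3 := congrArg (res M hV') h2
  rwa [res_res, res_self, res_zero] at h3

/-- A section of a quasi-coherent sheaf over the locus where `f` is invertible extends to the affine
open subset after multiplication by a power of `f`. -/
theorem exists_res_eq_pow_smul {V : X.Opens} (hV : IsAffineOpen V) (M : X.Modules)
    [M.IsQuasicoherent] (f : Γ(X, V)) (t : Γ(M, X.basicOpen f)) :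
    ∃ (n : ℕ) (s : Γ(M, V)), res M (X.basicOpen_le f) s = resO (X.basicOpen_le f) (f ^ n) • t := by
  let j := hV.fromSpec
  have hle := image_fromSpec_le hV
  let D : (Spec Γ(X, V)).Opens := PrimeSpectrum.basicOpen f
  have hf : j ''ᵁ D = X.basicOpen f := image_fromSpec_basicOpen_eq hV f rfl
  let t' : Γ(M.restrict j, D) := (ofRestrict M j D).symm (res M hf.le t)
  obtain ⟨n, s', hn⟩ := (isLocalizing_restrict_fromSpec hV M).exists_res_eq_smul f rfl t'
  have hV' : V ≤ j ''ᵁ ⊤ := by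
    rw [Scheme.Hom.image_top_eq_opensRange, hV.opensRange_fromSpec]
  refine ⟨n, res M hV' (ofRestrict M j ⊤ s'), ?_⟩
  have h1 := congrArg (ofRestrict M j D) hn.symm
  have h2 : resO (hle _) (f ^ n) • res M hf.le t = res M (j.image_mono le_top)
    (ofRestrict M j ⊤ s') :=
    (ofRestrict_fromSpec_smul hV M _ (f ^ n) t').symm.trans h1
  have h3 := congrArg (res M hf.ge) h2
  rw [res_smul, res_res, res_self, res_res] at h3
  rw [res_res, ← h3]
  simp only [resO_resO]

end

end CurveSheaf

/-! ### Homomorphisms out of quasi-coherent sheaves -/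

namespace CurveSheaf

noncomputable section

variable {X Y : Scheme.{u}} {M N : X.Modules} {V : X.Opens}

theorem isUnit_resO_pow {f : Γ(X, V)} {W : X.Opens} (h : W ≤ X.basicOpen f) (n : ℕ) :
    IsUnit (resO (h.trans (X.basicOpen_le f)) (f ^ n)) := by
  rw [← resO_resO (X.basicOpen_le f) h, resO, resO, map_pow, map_pow]
  exact ((RingedSpace.isUnit_res_basicOpen _ f).map (X.presheaf.map (homOfLE h).op).hom).pow n

theorem exists_pow_smul_eq_zero_of_res (hV : IsAffineOpen V) [M.IsQuasicoherent] {W : X.Opens}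
    (hW : W ≤ V) {m : Γ(M, V)}
    (hm : res M hW m = 0) {x : X} (hx : x ∈ W) :
    ∃ f : Γ(X, V), X.basicOpen f ≤ W ∧ x ∈ X.basicOpen f ∧ ∃ n : ℕ, f ^ n • m = 0 := by
  obtain ⟨f, hf, hxf⟩ := hV.exists_basicOpen_le ⟨x, hx⟩ (hW hx)
  refine ⟨f, hf, hxf, exists_pow_smul_eq_zero hV M f m ?_⟩
  rw [← res_res M hW hf, hm, res_zero]

/-- Linear maps between sections over an affine open subset are local. -/
theorem res_map_eq_zero (hV : IsAffineOpen V) [M.IsQuasicoherent]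
    (θ : Γ(M, V) →ₗ[Γ(X, V)] Γ(N, V)) {W : X.Opens}
    (hW : W ≤ V) {m : Γ(M, V)} (hm : res M hW m = 0) : res N hW (θ m) = 0 := by
  refine eq_of_locally_eq N _ _ fun x hx => ?_
  obtain ⟨f, hf, hxf, n, hn⟩ := exists_pow_smul_eq_zero_of_res hV hW hm hx
  refine ⟨X.basicOpen f, hf, hxf, ?_⟩
  have h1 := congrArg (res N (X.basicOpen_le f)) (congrArg θ hn)
  rw [map_smul, res_smul, map_zero, res_zero] at h1
  rw [res_res, res_zero]
  exact (isUnit_resO_pow le_rfl n).smul_left_cancel.mp (h1.trans (smul_zero _).symm)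

/-- Sections of a quasi-coherent sheaf over open subsets of an affine `V` are locally fractions. -/
theorem exists_unit_smul_eq_res (hV : IsAffineOpen V) [M.IsQuasicoherent] {W : X.Opens}
    (hW : W ≤ V) (s : Γ(M, W)) {x : X} (hx : x ∈ W) :
    ∃ (W' : X.Opens) (h : W' ≤ W), x ∈ W' ∧ ∃ (r : Γ(X, V)) (m : Γ(M, V)),
      IsUnit (resO (h.trans hW) r) ∧ res M (h.trans hW) m = resO (h.trans hW) r • res M h s := by
  obtain ⟨f, hf, hxf⟩ := hV.exists_basicOpen_le ⟨x, hx⟩ (hW hx)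
  obtain ⟨n, m, hm⟩ := exists_res_eq_pow_smul hV M f (res M hf s)
  exact ⟨X.basicOpen f, hf, hxf, f ^ n, m, isUnit_resO_pow le_rfl n, hm⟩

/-- Sections of `Hom(M, N)` over an affine open subset are determined by their effect on the
sections over it. -/
theorem eq_of_evalHom_eq (hV : IsAffineOpen V) [M.IsQuasicoherent]
    {α β : Γ(sheafHom M N, V)} (h : ∀ m, evalHom α le_rfl m = evalHom β le_rfl m) : α = β := by
  refine evalHom_ext fun W hW s => eq_of_locally_eq N _ _ fun x hx => ?_
  obtain ⟨W', hW', hxW', r, m, hr, hm⟩ := exists_unit_smul_eq_res hV hW s hx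
  refine ⟨W', hW', hxW', hr.smul_left_cancel.mp ?_⟩
  rw [res_evalHom, res_evalHom, ← map_smul (evalHom α _),
    ← map_smul (evalHom β _), ← hm, ← res_evalHom α le_rfl,
    ← res_evalHom β le_rfl, h]

/-- `s` and `c` are, up to a common unit denominator, the restrictions of a section `m` over `V` and
of `θ m`. -/
def IsFraction (θ : Γ(M, V) →ₗ[Γ(X, V)] Γ(N, V)) {W : X.Opens} (hW : W ≤ V) (s : Γ(M, W))
    (c : Γ(N, W)) : Prop :=
  ∃ (r : Γ(X, V)) (m : Γ(M, V)), IsUnit (resO hW r) ∧ res M hW m = resO hW r • s ∧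
    res N hW (θ m) = resO hW r • c

namespace IsFraction

variable {θ : Γ(M, V) →ₗ[Γ(X, V)] Γ(N, V)} {W : X.Opens} {hW : W ≤ V} {s t : Γ(M, W)}
  {c d : Γ(N, W)}

theorem restrict {W' : X.Opens} (h : W' ≤ W) (hc : IsFraction θ hW s c) :
    IsFraction θ (h.trans hW) (res M h s) (res N h c) := by
  obtain ⟨r, m, hr, hm, hθ⟩ := hc
  refine ⟨r, m, ?_, ?_, ?_⟩
  · rw [← resO_resO hW h]
    exact hr.map (X.presheaf.map (homOfLE _).op).hom
  · rw [← res_res M hW h, hm, res_smul, resO_resO]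
  · rw [← res_res N hW h, hθ, res_smul, resO_resO]

theorem unique (hV : IsAffineOpen V) [M.IsQuasicoherent] (hc : IsFraction θ hW s c)
    (hd : IsFraction θ hW s d) : c = d := by
  obtain ⟨r, m, hr, hm, hθ⟩ := hc
  obtain ⟨r', m', hr', hm', hθ'⟩ := hd
  have h0 : res M hW (r' • m - r • m') = 0 := by
    rw [res_sub, res_smul, res_smul, hm, hm', smul_smul, smul_smul, mul_comm, sub_self]
  have h1 := res_map_eq_zero hV θ hW h0
  rw [map_sub, map_smul, map_smul, res_sub, res_smul, res_smul, hθ, hθ', smul_smul, smul_smul,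
    mul_comm, sub_eq_zero] at h1
  exact (hr.mul hr').smul_left_cancel.mp h1

theorem add (hc : IsFraction θ hW s c) (hd : IsFraction θ hW t d) :
    IsFraction θ hW (s + t) (c + d) := by
  obtain ⟨r, m, hr, hm, hθ⟩ := hc
  obtain ⟨r', m', hr', hm', hθ'⟩ := hd
  refine ⟨r * r', r' • m + r • m', ?_, ?_, ?_⟩
  · rw [resO_mul]
    exact hr.mul hr'
  · rw [res_add, res_smul, res_smul, hm, hm', resO_mul, smul_add, smul_smul, smul_smul,
      mul_comm (resO hW r')]
  · rw [map_add, map_smul, map_smul, res_add, res_smul, res_smul, hθ, hθ', resO_mul, smul_add,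
      smul_smul, smul_smul, mul_comm (resO hW r')]

/-- Up to shrinking, functions on `W` are fractions too, so that they can multiply `s` and `c`. -/
theorem smul (hV : IsAffineOpen V) (a : Γ(X, W)) (hc : IsFraction θ hW s c) {x : X} (hx : x ∈ W) :
    ∃ (W' : X.Opens) (h : W' ≤ W), x ∈ W' ∧
      IsFraction θ (h.trans hW) (res M h (a • s)) (res N h (a • c)) := by
  obtain ⟨r, m, hr, hm, hθ⟩ := hc
  obtain ⟨f, hf, hxf⟩ := hV.exists_basicOpen_le ⟨x, hx⟩ (hW hx)
  have := hV.isLocalization_basicOpen f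
  obtain ⟨⟨a', ⟨_, n, rfl⟩⟩, ha⟩ := IsLocalization.surj (Submonoid.powers f) (resO hf a)
  have ha' : resO hf a * resO (hf.trans hW) (f ^ n) = resO (hf.trans hW) a' := ha
  refine ⟨X.basicOpen f, hf, hxf, f ^ n * r, a' • m, ?_, ?_, ?_⟩
  · rw [resO_mul, ← resO_resO hW hf r]
    exact (isUnit_resO_pow le_rfl n).mul (hr.map (X.presheaf.map (homOfLE _).op).hom)
  · rw [res_smul, ← res_res M hW hf m, hm, res_smul, resO_resO, res_smul, smul_smul, smul_smul,
      ← ha', resO_mul]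
    congr 1
    ring
  · rw [map_smul, res_smul, ← res_res N hW hf (θ m), hθ, res_smul, resO_resO, res_smul, smul_smul,
      smul_smul, ← ha', resO_mul]
    congr 1
    ring

end IsFraction

/-- `c` is the value at `s` of the extension of `θ` to a morphism of sheaves. By quasi-coherence
this describes a unique section `c`, see `IsValueAt.unique` and
`IsValueAt.exists_of_isQuasicoherent`. -/
def IsValueAt (θ : Γ(M, V) →ₗ[Γ(X, V)] Γ(N, V)) {W : X.Opens} (hW : W ≤ V) (s : Γ(M, W))
    (c : Γ(N, W)) : Prop :=
  ∀ x ∈ W, ∃ (W' : X.Opens) (h : W' ≤ W), x ∈ W' ∧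
    IsFraction θ (h.trans hW) (res M h s) (res N h c)

namespace IsValueAt

variable {θ : Γ(M, V) →ₗ[Γ(X, V)] Γ(N, V)} {W : X.Opens} {hW : W ≤ V} {s t : Γ(M, W)}
  {c d : Γ(N, W)}

theorem restrict {W' : X.Opens} (h : W' ≤ W) (hc : IsValueAt θ hW s c) :
    IsValueAt θ (h.trans hW) (res M h s) (res N h c) := by
  intro x hx
  obtain ⟨W₁, h₁, hx₁, hf⟩ := hc x (h hx)
  refine ⟨W₁ ⊓ W', inf_le_right, ⟨hx₁, hx⟩, ?_⟩
  have := hf.restrict (inf_le_left : W₁ ⊓ W' ≤ W₁)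
  rw [res_res, res_res] at this
  rwa [res_res, res_res]

theorem unique (hV : IsAffineOpen V) [M.IsQuasicoherent] (hc : IsValueAt θ hW s c)
    (hd : IsValueAt θ hW s d) : c = d := by
  refine eq_of_locally_eq N _ _ fun x hx => ?_
  obtain ⟨W₁, h₁, hx₁, hf⟩ := hc x hx
  obtain ⟨W₂, h₂, hx₂, hf'⟩ := hd x hx
  refine ⟨W₁ ⊓ W₂, inf_le_left.trans h₁, ⟨hx₁, hx₂⟩, ?_⟩
  have h3 := hf.restrict (inf_le_left : W₁ ⊓ W₂ ≤ W₁)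
  have h4 := hf'.restrict (inf_le_right : W₁ ⊓ W₂ ≤ W₂)
  rw [res_res, res_res] at h3 h4
  exact h3.unique hV h4

theorem add (hc : IsValueAt θ hW s c) (hd : IsValueAt θ hW t d) :
    IsValueAt θ hW (s + t) (c + d) := by
  intro x hx
  obtain ⟨W₁, h₁, hx₁, hf⟩ := hc x hx
  obtain ⟨W₂, h₂, hx₂, hf'⟩ := hd x hx
  refine ⟨W₁ ⊓ W₂, inf_le_left.trans h₁, ⟨hx₁, hx₂⟩, ?_⟩
  have h3 := hf.restrict (inf_le_left : W₁ ⊓ W₂ ≤ W₁)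
  have h4 := hf'.restrict (inf_le_right : W₁ ⊓ W₂ ≤ W₂)
  rw [res_res, res_res] at h3 h4
  rw [res_add, res_add]
  exact h3.add h4

theorem smul (hV : IsAffineOpen V) (a : Γ(X, W)) (hc : IsValueAt θ hW s c) :
    IsValueAt θ hW (a • s) (a • c) := by
  intro x hx
  obtain ⟨W₁, h₁, hx₁, hf⟩ := hc x hx
  obtain ⟨W₂, h₂, hx₂, hf'⟩ := hf.smul hV (resO h₁ a) hx₁
  refine ⟨W₂, h₂.trans h₁, hx₂, ?_⟩
  rwa [← res_smul, ← res_smul, res_res, res_res] at hf'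

theorem of_locally (h : ∀ x ∈ W, ∃ (W' : X.Opens) (h : W' ≤ W), x ∈ W' ∧
    IsValueAt θ (h.trans hW) (res M h s) (res N h c)) : IsValueAt θ hW s c := by
  intro x hx
  obtain ⟨W₁, h₁, hx₁, hf⟩ := h x hx
  obtain ⟨W₂, h₂, hx₂, hf'⟩ := hf x hx₁
  refine ⟨W₂, h₂.trans h₁, hx₂, ?_⟩
  rwa [res_res, res_res] at hf'

theorem exists_of_isQuasicoherent (hV : IsAffineOpen V) [M.IsQuasicoherent]
    (θ : Γ(M, V) →ₗ[Γ(X, V)] Γ(N, V)) {W : X.Opens} (hW : W ≤ V) (s : Γ(M, W)) :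
    ∃ c, IsValueAt θ hW s c := by
  obtain ⟨c, hc⟩ := exists_of_locally_exists N
    (fun W' c => ∃ h : W' ≤ W, IsValueAt θ (h.trans hW) (res M h s) c)
    (by
      rintro W₁ W₂ h₂ c ⟨h₁, hc⟩
      refine ⟨h₂.trans h₁, ?_⟩
      rw [← res_res M h₁ h₂]
      exact hc.restrict h₂)
    (by
      rintro W₁ c d ⟨h₁, hc⟩ ⟨_, hd⟩
      exact hc.unique hV hd)
    (U := W) (by
      intro x hx
      obtain ⟨W', h, hx', r, m, hr, hm⟩ := exists_unit_smul_eq_res hV hW s hx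
      refine ⟨W', h, hx', (↑hr.unit⁻¹ : Γ(X, W')) • res N (h.trans hW) (θ m), h, ?_⟩
      intro y hy
      refine ⟨W', le_rfl, hy, r, m, hr, ?_, ?_⟩
      · rw [res_self, hm]
      · rw [res_self, smul_smul, IsUnit.mul_val_inv, one_smul])
  exact ⟨c, of_locally fun x hx => by
    obtain ⟨W', h, hx', _, hW'⟩ := hc x hx
    exact ⟨W', h, hx', hW'⟩⟩

end IsValueAt

/-- Linear maps out of the sections of a quasi-coherent sheaf over an affine open subset come from
morphisms of sheaves. -/
theorem exists_evalHom_eq (hV : IsAffineOpen V) [M.IsQuasicoherent]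
    (θ : Γ(M, V) →ₗ[Γ(X, V)] Γ(N, V)) :
    ∃ α : Γ(sheafHom M N, V), ∀ m, evalHom α le_rfl m = θ m := by
  choose f hf using fun (W : X.Opens) (hW : W ≤ V) (s : Γ(M, W)) =>
    IsValueAt.exists_of_isQuasicoherent hV θ hW s
  refine ⟨mkHom (fun W hW =>
    { toFun := f W hW
      map_add' := fun s t => (hf W hW _).unique hV ((hf W hW s).add (hf W hW t))
      map_smul' := fun a s => (hf W hW _).unique hV ((hf W hW s).smul hV a) }) ?_, fun m => ?_⟩
  · intro W W' hW h s
    exact ((hf W hW s).restrict h).unique hV (hf W' (h.trans hW) _)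
  · refine (hf V le_rfl m).unique hV fun x hx => ⟨V, le_rfl, hx, 1, m, ?_, ?_, ?_⟩
    · rw [resO_self]
      exact isUnit_one
    · rw [resO_self, one_smul]
    · rw [resO_self, one_smul]

/-! ### Associated points -/

/-- On a locally noetherian scheme, a quasi-coherent sheaf whose associated points are generic has
no torsion sections. -/
theorem torsionSections_eq_bot [IsLocallyNoetherian X] (M : X.Modules) [M.IsQuasicoherent]
    (hM : ∀ x : X, IsAssociatedPoint M x → x ∈ genericPoints X) (U : X.Opens) :
    torsionSections M U = ⊥ := by
  rw [eq_bot_iff]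
  intro s₀ hs₀
  refine eq_of_locally_eq M _ _ fun x hx => ?_
  obtain ⟨V, hV, hxV, hVU' : V ≤ U⟩ := exists_isAffineOpen_mem_and_subset hx
  have hVU : V ≤ U := hVU'
  refine ⟨V, hVU, hxV, ?_⟩
  rw [res_zero]
  by_contra hs
  set s : Γ(M, V) := res M hVU s₀ with hsdef
  have hnoeth : IsNoetherianRing Γ(X, V) := IsLocallyNoetherian.component_noetherian ⟨V, hV⟩
  -- An associated prime of the module generated by `s` is the annihilator of a multiple `a • s`.
  let s' : Submodule.span Γ(X, V) {s} := ⟨s, Submodule.mem_span_singleton_self s⟩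
  have hs' : s' ≠ 0 := fun h => hs (congrArg Subtype.val h)
  obtain ⟨P, hP, -⟩ := exists_le_isAssociatedPrime_of_isNoetherianRing Γ(X, V) s' hs'
  obtain ⟨hprime, ⟨t, ht⟩, htP⟩ := isAssociatedPrime_iff.mp hP
  obtain ⟨a, rfl⟩ := Submodule.mem_span_singleton.mp ht
  have hPmem : ∀ c : Γ(X, V), c ∈ P ↔ c • (a • s) = 0 := by
    intro c
    rw [htP, Submodule.mem_colon_singleton, Submodule.mem_bot, ← Subtype.val_inj]
    rfl
  let y : X := hV.fromSpec ⟨P, hprime⟩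
  have hy : y ∈ V := (image_fromSpec_le hV ⊤) ⟨_, trivial, rfl⟩
  let _ := X.presheaf.algebra_section_stalk ⟨y, hy⟩
  have hloc : IsLocalization.AtPrime (X.presheaf.stalk y) P :=
    hV.isLocalization_stalk' ⟨P, hprime⟩ hy
  have halg : ∀ c, algebraMap Γ(X, V) (X.presheaf.stalk y) c = X.presheaf.germ V y hy c :=
    fun c => rfl
  have hmax : ∀ c : Γ(X, V), X.presheaf.germ V y hy c ∈
      IsLocalRing.maximalIdeal (X.presheaf.stalk y) ↔ c ∈ P := fun c =>
    IsLocalization.AtPrime.to_map_mem_maximal_iff (X.presheaf.stalk y) P c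
  have hass : IsAssociatedPoint M y := by
    refine ⟨germ M y hy (a • s), fun q => ?_⟩
    obtain ⟨⟨c, u⟩, hcu⟩ := IsLocalization.surj P.primeCompl q
    have hu : IsUnit (X.presheaf.germ V y hy u) := by
      by_contra hcon
      exact u.2 ((hmax _).mp ((IsLocalRing.mem_maximalIdeal _).mpr hcon))
    have hcu' : q * X.presheaf.germ V y hy u = X.presheaf.germ V y hy c := hcu
    have h1 : q ∈ IsLocalRing.maximalIdeal (X.presheaf.stalk y) ↔ c ∈ P := by
      rw [← hmax, ← hcu', Ideal.mul_unit_mem_iff_mem _ hu]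
    have h2 : q • germ M y hy (a • s) = 0 ↔ germ M y hy (c • a • s) = 0 := by
      have h3 : germ M y hy (c • a • s) =
        X.presheaf.germ V y hy c • germ M y hy (a • s) := germ_smul M y V hy c _
      rw [h3, ← hcu', mul_comm, mul_smul]
      exact ⟨fun h => by rw [h, smul_zero],
        fun h => hu.smul_left_cancel.mp (h.trans (smul_zero _).symm)⟩
    rw [h1, h2, germ_eq_zero_iff]
    constructor
    · intro hc
      exact ⟨V, le_rfl, hy, by rw [(hPmem c).mp hc, res_zero]⟩
    · rintro ⟨W, hW, hyW, hz⟩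
      obtain ⟨f, hf, hyf, n, hn⟩ := exists_pow_smul_eq_zero_of_res hV hW hz hyW
      have hfP : f ∉ P := fun hmem =>
        ((IsLocalRing.mem_maximalIdeal _).mp ((hmax f).mpr hmem))
          ((X.mem_basicOpen f y hy).mp hyf)
      rw [smul_smul, ← hPmem] at hn
      exact (hprime.mem_or_mem hn).resolve_left fun h => hfP (hprime.mem_of_pow_mem n h)
  have h0 : germ M y hy s = 0 := by
    rw [hsdef, germ_res]
    exact hs₀ y (hVU hy) (hM y hass)
  have h1 : (1 : Γ(X, V)) ∈ P := by
    obtain ⟨W, hW, hyW, hz⟩ := (germ_eq_zero_iff M hy s).mp h0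
    obtain ⟨f, hf, hyf, n, hn⟩ := exists_pow_smul_eq_zero_of_res hV hW hz hyW
    have hfP : f ∉ P := fun hmem =>
      ((IsLocalRing.mem_maximalIdeal _).mp ((hmax f).mpr hmem))
        ((X.mem_basicOpen f y hy).mp hyf)
    have : f ^ n ∈ P := (hPmem _).mpr (by rw [smul_comm, hn, smul_zero])
    exact absurd (hprime.mem_of_pow_mem n this) hfP
  exact hprime.ne_top ((Ideal.eq_top_iff_one P).mpr h1)

end

end CurveSheaf

/-! ### Birational morphisms -/

namespace CurveSheaf

noncomputable section

variable {X Y : Scheme.{u}} (b : Y ⟶ X)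

section Birational

variable (U₀ : X.Opens) [IsIso (b ∣_ U₀)]

/-- The section of `b` over an open subset over which `b` is an isomorphism. -/
def localSection : (U₀ : Scheme.{u}) ⟶ Y := inv (b ∣_ U₀) ≫ (b ⁻¹ᵁ U₀).ι

theorem localSection_comp : localSection b U₀ ≫ b = U₀.ι := by
  rw [localSection, Category.assoc, ← morphismRestrict_ι, IsIso.inv_hom_id_assoc]

instance : IsOpenImmersion (localSection b U₀ ≫ b) := by
  rw [localSection_comp]
  infer_instance

theorem localSection_comp_apply (z : U₀) : (localSection b U₀ ≫ b) z = z.1 := by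
  rw [localSection_comp]
  rfl

/-- Over `U₀` the morphism `b` is injective. -/
theorem eq_of_apply_eq {y y' : Y} (hy : b y ∈ U₀) (h : b y = b y') : y = y' := by
  have hinj : Function.Injective (b ∣_ U₀) := (b ∣_ U₀).homeomorph.injective
  have hy' : b y' ∈ U₀ := h ▸ hy
  have : (⟨y, hy⟩ : (b ⁻¹ᵁ U₀ : Y.Opens)) = ⟨y', hy'⟩ := by
    apply hinj
    apply Subtype.ext
    exact ((morphismRestrict_base_coe b U₀ _).trans h).trans (morphismRestrict_base_coe b U₀ _).symm
  exact congrArg Subtype.val this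

theorem bijective_app {V : X.Opens} (hV : V ≤ U₀) : Function.Bijective (b.app V) := by
  obtain ⟨W, rfl⟩ : ∃ W : (U₀ : Scheme.{u}).Opens, U₀.ι ''ᵁ W = V := by
    refine ⟨U₀.ι ⁻¹ᵁ V, ?_⟩
    rw [Scheme.Hom.image_preimage_eq_opensRange_inf]
    simpa using hV
  have h1 := morphismRestrict_app b U₀ W
  have h2 : IsIso (b.app (U₀.ι ''ᵁ W) ≫
      Y.presheaf.map (eqToHom (image_morphismRestrict_preimage b U₀ W)).op) :=
    h1 ▸ (inferInstance : IsIso (Scheme.Hom.app (b ∣_ U₀) W))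
  have h3 : IsIso (b.app (U₀.ι ''ᵁ W)) := IsIso.of_isIso_comp_right _
    (Y.presheaf.map (eqToHom (image_morphismRestrict_preimage b U₀ W)).op)
  exact ConcreteCategory.bijective_of_isIso _

theorem mem_genericPoints_of_apply {y : Y} (hy : b y ∈ U₀) (h : b y ∈ genericPoints X) :
    y ∈ genericPoints Y := by
  obtain ⟨η, hη, hηy⟩ := exists_genericPoints_specializes y
  have hsp : b η ⤳ b y := hηy.map b.continuous
  have hle : closure {b y} ⊆ closure {b η} :=
    closure_minimal (Set.singleton_subset_iff.mpr (specializes_iff_mem_closure.mp hsp))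
      isClosed_closure
  have hge := h.2 (isIrreducible_singleton (x := b η)).closure hle
  have hbη : b y = b η :=
    hsp.antisymm (specializes_iff_mem_closure.mpr (hge (subset_closure rfl))) |>.eq.symm
  rwa [eq_of_apply_eq b U₀ hy hbη]

end Birational

/-- The conductor multiplies functions upstairs into functions downstairs. -/
theorem exists_app_eq_of_mem_conductor (hinj : ∀ U : X.Opens, Function.Injective (b.app U))
    {U : X.Opens} {a : Γ(X, U)} (ha : a ∈ conductor b U) (u : Γ(Y, b ⁻¹ᵁ U)) :
    ∃ c : Γ(X, U), b.app U c = b.app U a * u := by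
  have hmono : Mono (comorphism b) := mono_of_injective _ fun U x y h => hinj U h
  let u' : Γ((Scheme.Modules.pushforward b).obj (structureSheaf Y), U) := ofO (b ⁻¹ᵁ U) u
  have h1 := ha U le_rfl ((Limits.cokernel.π (comorphism b)).app U u')
  rw [resO_self, ← Scheme.Modules.Hom.app_smul] at h1
  obtain ⟨c, hc⟩ := exists_app_eq_of_cokernel (comorphism b) _ h1
  exact ⟨c, hc⟩

theorem conductor_res {U V : X.Opens} (h : V ≤ U) {a : Γ(X, U)} (ha : a ∈ conductor b U) :
    resO h a ∈ conductor b V := by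
  intro W hW s
  rw [resO_resO]
  exact ha W (hW.trans h) s

/-- If `J` is torsion-free and `J^b` is invertible, every point `x` has a neighbourhood `V`,
meeting the complement of `U₀` at most in `x`, and a section `g` of `J` over `V` such that nonzero
functions do not annihilate `g`, every section of `J` is a multiple of `g` over `V ∩ U₀`, and the
conductor multiplies sections of `J` into multiples of `g`. -/
theorem exists_conductor_generator {k : Type u} [Field k] [IsAlgClosed k]
    {p : X ⟶ Spec (.of k)} {p' : Y ⟶ Spec (.of k)} (hX : IsCurve p) (hY : IsCurve p')
    (hbk : b ≫ p = p') {U₀ : X.Opens} (hd : Dense (U₀ : Set X))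
    (hd' : Dense ((b ⁻¹ᵁ U₀ : Y.Opens) : Set Y)) [IsIso (b ∣_ U₀)] {J : X.Modules}
    (hJ : ∀ U, torsionSections J U = ⊥) (hQ : IsInvertible (pullbackModTorsion b J)) (x : X) :
    ∃ (V : X.Opens) (g : Γ(J, V)), x ∈ V ∧ (∀ y ∈ V, y ∉ U₀ → y = x) ∧
      (∀ (W : X.Opens) (h : W ≤ V) (c : Γ(X, W)), c • res J h g = 0 → c = 0) ∧
      (∀ (W : X.Opens) (h : W ≤ V), W ≤ U₀ → ∀ s : Γ(J, W), ∃ c : Γ(X, W), s = c • res J h g) ∧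
      ∀ (W : X.Opens) (h : W ≤ V), ∀ a ∈ conductor b W, ∀ s : Γ(J, W),
        ∃ c : Γ(X, W), a • s = c • res J h g := by
  have := hX.reduced
  have hXn := hX.projective.isNoetherian
  have hYn := hY.projective.isNoetherian
  have : IsProper p := hX.projective.isProper
  have hprop : IsProper p' := hY.projective.isProper
  have hbp : IsProper b := by
    have : IsProper (b ≫ p) := hbk ▸ hprop
    exact IsProper.of_comp b p
  have hgen : ∀ η ∈ genericPoints X, ∃ z, (localSection b U₀ ≫ b) z = η := fun η hη =>
    ⟨⟨η, genericPoints_subset_of_dense U₀.isOpen hd hη⟩, localSection_comp_apply b U₀ _⟩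
  have hinj := app_injective b (localSection b U₀) hgen
  have hpull := pullSection_injective b J (localSection b U₀) hgen (fun z hz => by
    refine mem_genericPoints_of_apply b U₀ ?_ hz
    have := localSection_comp_apply b U₀ z
    rw [Scheme.Hom.comp_apply] at this
    rw [this]
    exact z.2) hJ
  have hfin : (b ⁻¹' {x}).Finite := by
    by_cases hx : x ∈ U₀
    · refine Set.Subsingleton.finite fun y hy y' hy' => eq_of_apply_eq b U₀ ?_ (hy.trans hy'.symm)
      rw [show b y = x from hy]
      exact hx
    · refine (finite_compl_of_dense hY.pure_dim (b ⁻¹ᵁ U₀).isOpen hd').subset fun y hy hyU => hx ?_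
      rw [← show b y = x from hy]
      exact hyU
  let σ : k →+* Γ(X, ⊤) := p.appTop.hom.comp (Scheme.ΓSpecIso (.of k)).inv.hom
  have : Infinite k := IsAlgClosed.instInfinite
  obtain ⟨U, g, hxU, hg⟩ := exists_isFreeGenerator_pullSection σ b.isClosedMap hQ x hfin
  -- The finite set of points to be removed from the neighbourhood of `x`.
  let T : Set X := (U₀ : Set X)ᶜ \ {x}
  have hT : IsClosed T := by
    have hTf : T.Finite := (finite_compl_of_dense hX.pure_dim U₀.isOpen hd).subset Set.sdiff_subset
    rw [← Set.biUnion_of_singleton T]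
    exact hTf.isClosed_biUnion fun y hy =>
      isClosed_singleton_of_notMem_dense hX.pure_dim U₀.isOpen hd hy.1
  let V : X.Opens := U ⊓ ⟨Tᶜ, hT.isOpen_compl⟩
  have hVU : V ≤ U := inf_le_left
  have hgW : ∀ (W : X.Opens) (h : W ≤ V), IsFreeGenerator (pullbackModTorsion b J)
      (pullSection b J W (res J h (res J hVU g))) := by
    intro W h
    rw [res_res, pullSection_res]
    exact hg.restrict _
  have hcoef : ∀ (W : X.Opens) (h : W ≤ V) (s : Γ(J, W)), ∃ u : Γ(Y, b ⁻¹ᵁ W),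
      pullSection b J W s = u • pullSection b J W (res J h (res J hVU g)) := by
    intro W h s
    obtain ⟨u, hu⟩ := (hgW W h _ le_rfl).2 (pullSection b J W s)
    refine ⟨u, hu.symm.trans ?_⟩
    rw [res_self]
  refine ⟨V, res J hVU g, ⟨hxU, fun hx => hx.2 rfl⟩, fun y hy hyU => ?_, ?_, ?_, ?_⟩
  · by_contra hne
    exact hy.2 ⟨hyU, hne⟩
  · intro W h c hc
    have h1 := congrArg (pullSection b J W) hc
    rw [pullSection_smul, map_zero] at h1
    refine hinj W (((hgW W h _ le_rfl).1 (a₁ := b.app W c) (a₂ := 0) ?_).trans (map_zero _).symm)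
    simp only [res_self]
    rw [h1, zero_smul]
  · intro W h hW s
    obtain ⟨u, hu⟩ := hcoef W h s
    obtain ⟨c, rfl⟩ := (bijective_app b U₀ hW).2 u
    refine ⟨c, hpull W ?_⟩
    rw [hu, pullSection_smul]
  · intro W h a ha s
    obtain ⟨u, hu⟩ := hcoef W h s
    obtain ⟨c, hc⟩ := exists_app_eq_of_mem_conductor b hinj ha u
    refine ⟨c, hpull W ?_⟩
    rw [pullSection_smul, pullSection_smul, hu, hc, mul_smul]

end

end CurveSheaf

/-! ### Subsheaves of the dual -/

namespace CurveSheaf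

noncomputable section

variable {X : Scheme.{u}}

/-- The subsheaf of `J` that agrees with `J` on `U₀` and is generated by `g x` near each point `x`
outside `U₀`. -/
def locallyGenerated (J : X.Modules) (U₀ : X.Opens) {V : X → X.Opens} (hxV : ∀ x, x ∈ V x)
    (g : ∀ x, Γ(J, V x)) : LocalSubmodule J where
  carrier W :=
    { carrier := {s | ∀ x ∈ W, x ∉ U₀ → ∃ (W' : X.Opens) (h : W' ≤ W) (h' : W' ≤ V x), x ∈ W' ∧
        ∃ c : Γ(X, W'), res J h s = c • res J h' (g x)}
      zero_mem' := fun x hx hxU =>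
        ⟨W ⊓ V x, inf_le_left, inf_le_right, ⟨hx, hxV x⟩, 0, by rw [res_zero, zero_smul]⟩
      add_mem' := by
        intro s t hs ht x hx hxU
        obtain ⟨W₁, h₁, h₁', hx₁, c, hc⟩ := hs x hx hxU
        obtain ⟨W₂, h₂, h₂', hx₂, d, hd⟩ := ht x hx hxU
        refine ⟨W₁ ⊓ W₂, inf_le_left.trans h₁, inf_le_left.trans h₁', ⟨hx₁, hx₂⟩,
          resO inf_le_left c + resO inf_le_right d, ?_⟩
        rw [add_smul, res_add, ← res_res J h₁ inf_le_left, hc, ← res_res J h₂ inf_le_right, hd,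
          res_smul, res_smul, res_res, res_res]
      smul_mem' := by
        intro a s hs x hx hxU
        obtain ⟨W₁, h₁, h₁', hx₁, c, hc⟩ := hs x hx hxU
        exact ⟨W₁, h₁, h₁', hx₁, resO h₁ a * c, by rw [res_smul, hc, mul_smul]⟩ }
  res_mem := by
    intro W W₀ h s hs x hx hxU
    obtain ⟨W₁, h₁, h₁', hx₁, c, hc⟩ := hs x (h hx) hxU
    refine ⟨W₁ ⊓ W₀, inf_le_right, inf_le_left.trans h₁', ⟨hx₁, hx⟩, resO inf_le_left c, ?_⟩
    rw [res_res, ← res_res J h₁ inf_le_left, hc, res_smul, res_res]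
  mem_of_locally := by
    intro W s hs x hx hxU
    obtain ⟨W₀, h, hx₀, hW₀⟩ := hs x hx
    obtain ⟨W₁, h₁, h₁', hx₁, c, hc⟩ := hW₀ x hx₀ hxU
    exact ⟨W₁, h₁.trans h, h₁', hx₁, c, by rw [← res_res J h h₁, hc]⟩

section

variable {J : X.Modules} {U₀ : X.Opens} {V : X → X.Opens} {hxV : ∀ x, x ∈ V x}
  {g : ∀ x, Γ(J, V x)}

theorem mem_locallyGenerated (hV : ∀ x, ∀ y ∈ V x, y ∉ U₀ → y = x) (x : X) :
    g x ∈ (locallyGenerated J U₀ hxV g).carrier (V x) := by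
  intro y hy hyU
  obtain rfl := hV x y hy hyU
  exact ⟨V y, le_rfl, le_rfl, hy, 1, by rw [one_smul]⟩

/-- Since `V x` contains no point outside `U₀` other than `x`, the subsheaf `locallyGenerated` is
freely generated by `g x` on all of `V x`. -/
theorem isFreeGenerator_locallyGenerated (hV : ∀ x, ∀ y ∈ V x, y ∉ U₀ → y = x)
    (hinj : ∀ (x : X) (W : X.Opens) (h : W ≤ V x) (c : Γ(X, W)), c • res J h (g x) = 0 → c = 0)
    (hgen : ∀ (x : X) (W : X.Opens) (h : W ≤ V x), W ≤ U₀ → ∀ s : Γ(J, W),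
      ∃ c : Γ(X, W), s = c • res J h (g x)) (x : X) :
    IsFreeGenerator (locallyGenerated J U₀ hxV g).sheaf
      (((locallyGenerated J U₀ hxV g).sections (V x)).symm ⟨g x, mem_locallyGenerated hV x⟩) := by
  let A := locallyGenerated J U₀ hxV g
  refine isFreeGenerator_of_injective (fun W h c d hcd => ?_) fun W h s y hy => ?_
  · rw [← sub_eq_zero]
    refine hinj x W h _ ?_
    have h1 : c • res J h (g x) = d • res J h (g x) :=
      congrArg (fun s => (A.sections W s).1) hcd
    rw [sub_smul, h1, sub_self]
  · suffices ∃ (W' : X.Opens) (h' : W' ≤ W), y ∈ W' ∧ ∃ a : Γ(X, W'),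
        a • res J (h'.trans h) (g x) = res J h' (A.sections W s).1 by
      obtain ⟨W', h', hy', a, ha⟩ := this
      exact ⟨W', h', hy', a, (A.sections W').injective (Subtype.ext ha)⟩
    by_cases hyU : y ∈ U₀
    · obtain ⟨c, hc⟩ := hgen x (W ⊓ U₀) (inf_le_left.trans h) inf_le_right
        (res J inf_le_left (A.sections W s).1)
      exact ⟨W ⊓ U₀, inf_le_left, ⟨hy, hyU⟩, c, hc.symm⟩
    · obtain rfl := hV x y (h hy) hyU
      obtain ⟨W', h', _, hy', c, hc⟩ := (A.sections W s).2 y hy hyU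
      exact ⟨W', h', hy', c, hc.symm⟩

end

variable (I N : X.Modules)

variable {I N}

/-- Evaluation at a section of `I`, on a subsheaf `A` of `Hom(I, N)`. -/
def evalAt (A : LocalSubmodule (sheafHom I N)) {W : X.Opens} (s : Γ(I, W)) :
    Γ(A.sheaf, W) →ₗ[Γ(X, W)] Γ(N, W) where
  toFun a := evalHom (A.sections W a).1 le_rfl s
  map_add' a b := by rw [map_add, Submodule.coe_add, evalHom_add]
  map_smul' c a := by
    rw [RingHom.id_apply, map_smul, Submodule.coe_smul, evalHom_smul, resO_self]

theorem evalAt_apply (A : LocalSubmodule (sheafHom I N)) {W : X.Opens} (s : Γ(I, W))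
    (a : Γ(A.sheaf, W)) : evalAt A s a = evalHom (A.sections W a).1 le_rfl s := rfl

theorem res_evalAt (A : LocalSubmodule (sheafHom I N)) {W W' : X.Opens} (h : W' ≤ W) (s : Γ(I, W))
    (a : Γ(A.sheaf, W)) : res N h (evalAt A s a) = evalAt A (res I h s) (res A.sheaf h a) := by
  rw [evalAt_apply, evalAt_apply, res_evalHom, A.sections_res, evalHom_res]

/-- Evaluation at a section of `I`, as a section of `Hom(A, N)`. -/
def evalSection (A : LocalSubmodule (sheafHom I N)) {U : X.Opens} (s : Γ(I, U)) :
    Γ(sheafHom A.sheaf N, U) :=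
  mkHom (fun _ hW => evalAt A (res I hW s)) fun W W' hW h a => by rw [res_evalAt, res_res]

theorem evalHom_evalSection (A : LocalSubmodule (sheafHom I N)) {U W : X.Opens} (hW : W ≤ U)
    (s : Γ(I, U)) (a : Γ(A.sheaf, W)) :
    evalHom (evalSection A s) hW a = evalAt A (res I hW s) a := rfl

/-- The morphism `I → Hom(A, N)` given by evaluation, for a subsheaf `A` of `Hom(I, N)`. -/
def evalMorphism (A : LocalSubmodule (sheafHom I N)) : I ⟶ sheafHom A.sheaf N :=
  homMk (fun U =>
    { toFun := fun s => evalSection A s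
      map_add' := fun s t => evalHom_ext fun W hW a => by
        rw [evalHom_add, evalHom_evalSection, evalHom_evalSection, evalHom_evalSection,
          evalAt_apply, res_add, map_add]
        rfl
      map_smul' := fun c s => evalHom_ext fun W hW a => by
        rw [RingHom.id_apply, evalHom_smul, evalHom_evalSection, evalHom_evalSection,
          evalAt_apply, res_smul, map_smul]
        rfl })
    fun U W h s => evalHom_ext fun W' hW' a => by
      change evalHom (evalSection A (res I h s)) hW' a =
        evalHom (res (sheafHom A.sheaf N) h (evalSection A s)) hW' a
      rw [evalHom_res, evalHom_evalSection, evalHom_evalSection, res_res]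

theorem evalHom_evalMorphism (A : LocalSubmodule (sheafHom I N)) {U W : X.Opens} (hW : W ≤ U)
    (s : Γ(I, U)) (a : Γ(A.sheaf, W)) :
    evalHom ((evalMorphism A).app U s) hW a =
      evalHom (A.sections W a).1 le_rfl (res I hW s) := rfl

/-! ### Injectivity of the evaluation map -/

/-- Let `I` be torsion-free of rank one, and let `A` be a subsheaf of its dual which contains, near
each point, a functional not annihilated by nonzero functions. Then evaluation `I → Hom(A, 𝒪)` is
injective: at a generic point the value of such a functional at a generator of `I` is a unit. -/
theorem mono_evalMorphism [IsReduced X] [NoetherianSpace X] {I : X.Modules}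
    (hI : ∀ U, torsionSections I U = ⊥)
    (hrk : ∃ U : X.Opens, Dense (U : Set X) ∧ IsInvertible (I.restrict U.ι))
    (A : LocalSubmodule (sheafHom I (structureSheaf X))) {V : X → X.Opens} (hxV : ∀ x, x ∈ V x)
    (g : ∀ x, Γ(sheafHom I (structureSheaf X), V x)) (hgA : ∀ x, g x ∈ A.carrier (V x))
    (hinj : ∀ (x : X) (W : X.Opens) (h : W ≤ V x) (c : Γ(X, W)),
      c • res (sheafHom I (structureSheaf X)) h (g x) = 0 → c = 0) :
    Mono (evalMorphism A) := by
  refine mono_of_injective _ fun U => (injective_iff_map_eq_zero _).mpr fun s hs => ?_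
  have hmem : s ∈ torsionSections I U := by
    intro η hη hgen
    obtain ⟨U₁, hd, hU₁⟩ := hrk
    have hηU₁ : η ∈ U₁ := genericPoints_subset_of_dense U₁.isOpen hd hgen
    obtain ⟨W₁, e₁, hηW₁, he₁⟩ := hU₁.exists_isFreeGenerator ⟨η, hηU₁⟩
    have he₂ := he₁.of_restrict U₁.ι
    set W₂ := U₁.ι ''ᵁ W₁
    set e₂ : Γ(I, W₂) := ofRestrict I U₁.ι W₁ e₁
    have hηW₂ : η ∈ W₂ := ⟨_, hηW₁, rfl⟩
    let W : X.Opens := U ⊓ V η ⊓ W₂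
    have hηW : η ∈ W := ⟨⟨hη, hxV η⟩, hηW₂⟩
    have hWU : W ≤ U := inf_le_left.trans inf_le_left
    have hWV : W ≤ V η := inf_le_left.trans inf_le_right
    have he := he₂.restrict (inf_le_right : W ≤ W₂)
    set e : Γ(I, W) := res I inf_le_right e₂
    obtain ⟨c, hc⟩ := (he W le_rfl).2 (res I hWU s)
    simp only [res_self] at hc
    let u : Γ(X, W) := (ofO W).symm (evalHom (g η) hWV e)
    have hcu : c * u = 0 := by
      have h1 := evalHom_evalMorphism A hWU s
        ((A.sections W).symm ⟨res _ hWV (g η), A.res_mem hWV (hgA η)⟩)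
      rw [hs, LinearEquiv.apply_symm_apply, evalHom_res] at h1
      replace h1 : evalHom (g η) hWV (res I hWU s) = 0 := h1.symm
      rw [← hc, map_smul] at h1
      have h2 := congrArg (ofO W).symm h1
      rw [map_smul] at h2
      exact h2.trans (map_zero (ofO W).symm)
    have hsc : germ I η hη s = X.presheaf.germ W η hηW c • germ I η hηW e := by
      rw [← germ_res I hWU η hηW s, ← hc]
      exact germ_smul I η W hηW c e
    rcases eq_zero_or_isUnit_of_mem_genericPoints hgen (X.presheaf.germ W η hηW u) with hu | hu
    · exfalso
      obtain ⟨W', h', hηW', hu'⟩ := (germO_eq_iff hηW u 0).mp (hu.trans (map_zero _).symm)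
      have hg0 : res (sheafHom I (structureSheaf X)) (h'.trans hWV) (g η) = 0 := by
        refine (he.restrict h').eq_of_evalHom_eq ?_
        rw [evalHom_res, ← res_evalHom (g η) hWV h']
        refine (ofO W').symm.injective ?_
        rw [ofO_symm_res]
        refine hu'.trans ((map_zero _).trans ?_)
        rfl
      have h10 := hinj η W' (h'.trans hWV) 1 (by rw [hg0, smul_zero])
      have := congrArg (X.presheaf.germ W' η hηW') h10
      rw [map_one, map_zero] at this
      exact one_ne_zero this
    · have h1 := congrArg (X.presheaf.germ W η hηW) hcu
      rw [map_mul, map_zero, hu.mul_left_eq_zero] at h1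
      exact hsc.trans (by rw [h1, zero_smul])
  rw [hI] at hmem
  exact hmem

/-! ### The image of the evaluation map -/

/-- Let `A ⊆ Hom(I, 𝒪)` be freely generated by `g` near `x`, and let `a` be a function such that
`a Hom(I, 𝒪)` consists of multiples of `g`. Then `a` times a section `l` of the dual of `A` is,
near `x`, the evaluation at a section of `I`: the functional `h ↦ l (a h)` on the dual of `I` is
evaluation at an element of `I_x`, because the local ring is Gorenstein of dimension at most one. -/
theorem exists_evalMorphism_eq [IsLocallyNoetherian X]
    (hdim : ∀ (x : X) (P : Ideal (X.presheaf.stalk x)), P.IsPrime →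
      P ∈ minimalPrimes (X.presheaf.stalk x) ∨ P = IsLocalRing.maximalIdeal _)
    (hG : IsGorenstein X) {I : X.Modules} (hI : IsCoherent I)
    (A : LocalSubmodule (sheafHom I (structureSheaf X))) {x : X} {V : X.Opens} (hxV : x ∈ V)
    {g : Γ(sheafHom I (structureSheaf X), V)} (hgA : g ∈ A.carrier V)
    (hgen : IsFreeGenerator A.sheaf ((A.sections V).symm ⟨g, hgA⟩))
    (hinj : ∀ (W : X.Opens) (h : W ≤ V) (c : Γ(X, W)),
      c • res (sheafHom I (structureSheaf X)) h g = 0 → c = 0)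
    {U : X.Opens} (hxU : x ∈ U) (a : Γ(X, U))
    (ha : ∀ (W : X.Opens) (hU : W ≤ U) (h : W ≤ V) (s : Γ(sheafHom I (structureSheaf X), W)),
      ∃ c : Γ(X, W), resO hU a • s = c • res (sheafHom I (structureSheaf X)) h g)
    (l : Γ(sheafHom A.sheaf (structureSheaf X), U)) :
    ∃ (W : X.Opens) (h : W ≤ U), x ∈ W ∧ ∃ m : Γ(I, W),
      (evalMorphism A).app W m = res (sheafHom A.sheaf (structureSheaf X)) h (a • l) := by
  let J := sheafHom I (structureSheaf X)
  obtain ⟨B, hB, hxB, hBUV'⟩ := exists_isAffineOpen_mem_and_subset (show x ∈ U ⊓ V from ⟨hxU, hxV⟩)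
  have hBUV : B ≤ U ⊓ V := hBUV'
  have hBU : B ≤ U := hBUV.trans inf_le_left
  have hBV : B ≤ V := hBUV.trans inf_le_right
  have hqc := hI.1
  have hfin := hI.2 B hB
  have hnoeth : IsNoetherianRing Γ(X, B) := IsLocallyNoetherian.component_noetherian ⟨B, hB⟩
  -- The generator of `A` over `W ≤ V`.
  let gA : ∀ W : X.Opens, W ≤ V → Γ(A.sheaf, W) := fun W h =>
    res A.sheaf h ((A.sections V).symm ⟨g, hgA⟩)
  have hgAval : ∀ (W : X.Opens) (h : W ≤ V), (A.sections W (gA W h)).1 = res J h g :=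
    fun W h => rfl
  choose coef hcoef using fun s : Γ(J, B) => ha B hBU hBV s
  have huniq : ∀ c d : Γ(X, B), c • res J hBV g = d • res J hBV g → c = d := fun c d hcd => by
    rw [← sub_eq_zero]
    exact hinj B hBV _ (by rw [sub_smul, hcd, sub_self])
  choose ext hext using fun θ : Γ(I, B) →ₗ[Γ(X, B)] Γ(X, B) =>
    exists_evalHom_eq hB ((ofO B).toLinearMap ∘ₗ θ)
  let lg : Γ(X, B) := (ofO B).symm (evalHom l hBU (gA B hBV))
  -- The functional `h ↦ l (a h)`, with the dual of `Γ(I, B)` identified with `Γ(J, B)`.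
  let Ψ : (Γ(I, B) →ₗ[Γ(X, B)] Γ(X, B)) →ₗ[Γ(X, B)] Γ(X, B) :=
    { toFun := fun θ => coef (ext θ) * lg
      map_add' := fun θ θ' => by
        have h1 : ext (θ + θ') = ext θ + ext θ' := eq_of_evalHom_eq hB fun m => by
          rw [evalHom_add, hext, hext, hext]
          exact map_add (ofO B) _ _
        rw [← add_mul]
        congr 1
        refine huniq _ _ ?_
        rw [← hcoef, h1, smul_add, hcoef, hcoef, add_smul]
      map_smul' := fun c θ => by
        have h1 : ext (c • θ) = c • ext θ := eq_of_evalHom_eq hB fun m => by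
          rw [evalHom_smul, hext, hext, resO_self]
          exact map_smul (ofO B) _ _
        rw [RingHom.id_apply, smul_eq_mul, ← mul_assoc]
        congr 1
        refine huniq _ _ ?_
        rw [← hcoef, h1, smul_comm, hcoef, mul_smul] }
  let _ := X.presheaf.algebra_section_stalk ⟨x, hxB⟩
  let q := hB.primeIdealOf ⟨x, hxB⟩
  have hloc : IsLocalization.AtPrime (X.presheaf.stalk x) q.asIdeal :=
    hB.isLocalization_stalk ⟨x, hxB⟩
  obtain ⟨m, r, hr, hm⟩ := GorensteinDuality.exists_eval_at_prime q.asIdeal (hdim x) (hG x) Ψ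
  -- Apply this to the functional `g` itself.
  let θ : Γ(I, B) →ₗ[Γ(X, B)] Γ(X, B) := (ofO B).symm.toLinearMap ∘ₗ evalHom g hBV
  have hθ : ext θ = res J hBV g := eq_of_evalHom_eq hB fun m => by
    rw [hext]
    exact (ofO B).apply_symm_apply _
  have hΨθ : Ψ θ = resO hBU a * lg := by
    change coef (ext θ) * lg = _
    congr 1
    refine huniq _ _ ?_
    rw [← hcoef, hθ]
  have hgerm : X.presheaf.germ B x hxB (r * (resO hBU a * lg)) =
      X.presheaf.germ B x hxB ((ofO B).symm (evalHom g hBV m)) := by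
    have := hm θ
    rw [hΨθ] at this
    exact this
  have hrunit : IsUnit (X.presheaf.germ B x hxB r) :=
    (IsLocalization.AtPrime.isUnit_to_map_iff (X.presheaf.stalk x) q.asIdeal r).mpr hr
  obtain ⟨W₁, hW₁, hxW₁, hr₁⟩ := exists_isUnit_resO hxB hrunit
  obtain ⟨W₂, hW₂, hxW₂, heq⟩ := (germO_eq_iff hxB _ _).mp hgerm
  let W := W₁ ⊓ W₂
  have hWB : W ≤ B := inf_le_left.trans hW₁
  have hrW : IsUnit (resO hWB r) := by
    rw [← resO_resO hW₁ (inf_le_left : W ≤ W₁)]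
    exact hr₁.map (X.presheaf.map (homOfLE _).op).hom
  have heqW : resO hWB r * (resO (hWB.trans hBU) a * resO hWB lg) =
      resO hWB ((ofO B).symm (evalHom g hBV m)) := by
    have := congrArg (resO (inf_le_right : W ≤ W₂)) heq
    rw [resO_resO, resO_resO, resO_mul, resO_mul, resO_resO] at this
    exact this
  refine ⟨W, hWB.trans hBU, ⟨hxW₁, hxW₂⟩, (↑hrW.unit⁻¹ : Γ(X, W)) • res I hWB m, ?_⟩
  refine (hgen.restrict (hWB.trans hBV)).eq_of_evalHom_eq ?_
  refine hrW.smul_left_cancel.mp ((ofO W).symm.injective ?_)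
  have hlhs : evalHom ((evalMorphism A).app W ((↑hrW.unit⁻¹ : Γ(X, W)) • res I hWB m)) le_rfl
      (gA W (hWB.trans hBV)) = (↑hrW.unit⁻¹ : Γ(X, W)) • res _ hWB (evalHom g hBV m) := by
    rw [evalHom_evalMorphism, res_self, map_smul, hgAval, evalHom_res, res_evalHom]
  have hrhs : evalHom (res (sheafHom A.sheaf (structureSheaf X)) (hWB.trans hBU) (a • l)) le_rfl
      (gA W (hWB.trans hBV)) = resO (hWB.trans hBU) a • res _ hWB (evalHom l hBU (gA B hBV)) := by
    rw [evalHom_res, evalHom_smul, res_evalHom, res_res]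
  refine (congrArg (fun s => (ofO W).symm (resO hWB r • s)) hlhs).trans
    (Eq.trans ?_ (congrArg (fun s => (ofO W).symm (resO hWB r • s)) hrhs).symm)
  rw [smul_smul, IsUnit.mul_val_inv, one_smul, ofO_symm_res, ← heqW, map_smul, map_smul,
    ofO_symm_res]
  rfl

end

end CurveSheaf

open CurveSheaf in
theorem proposition5p1 {k : Type u} [Field k] [IsAlgClosed k]
    {C C' : Scheme.{u}} (p : C ⟶ Spec (.of k)) (p' : C' ⟶ Spec (.of k))
    (hC : CurveSheaf.IsCurve p) (hC' : CurveSheaf.IsCurve p')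
    (hG : CurveSheaf.IsGorenstein C)
    (b : C' ⟶ C) (hbk : b ≫ p = p') (hb : CurveSheaf.IsBirational b)
    (I : C.Modules) (hI : CurveSheaf.IsTorsionFreeRankOne I)
    (hInv : CurveSheaf.IsInvertible
      (CurveSheaf.pullbackModTorsion b (CurveSheaf.sheafHom I (CurveSheaf.structureSheaf C)))) :
    ∃ (L : C.Modules) (φ : I ⟶ L), CurveSheaf.IsInvertible L ∧ Mono φ ∧
      ∀ U : C.Opens,
        CurveSheaf.idealMul (CurveSheaf.conductor b) L U ⊆ CurveSheaf.image φ U := by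
  have hred := hC.reduced
  have hnoeth := hC.projective.isNoetherian
  have hqc := hI.coherent.1
  have hItors := torsionSections_eq_bot I hI.torsionFree
  let J := CurveSheaf.sheafHom I (structureSheaf C)
  -- `J` is torsion-free because functions on a reduced scheme are determined at generic points.
  have hJtors : ∀ U, torsionSections J U = ⊥ := by
    intro U
    rw [eq_bot_iff]
    intro α hα
    refine evalHom_ext fun W hW s => (ofO W).symm.injective ?_
    refine (eq_zero_of_genericPoints _ fun η hη hgen => ?_).trans (map_zero _).symm
    obtain ⟨W', h', hηW', hW'⟩ := (germ_eq_zero_iff J (hW hη) α).mp (hα η (hW hη) hgen)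
    refine (germO_eq_iff hη _ 0).mpr ⟨W ⊓ W', inf_le_left, ⟨hη, hηW'⟩, ?_⟩ |>.trans (map_zero _)
    have h1 : res (structureSheaf C) (inf_le_left : W ⊓ W' ≤ W) (evalHom α hW s) = 0 := by
      rw [res_evalHom, ← evalHom_res α h' inf_le_right, hW']
      rfl
    rw [← ofO_symm_res, h1]
    exact (map_zero (ofO (W ⊓ W')).symm).trans (map_zero _).symm
  obtain ⟨U₀, hd, hd', hiso⟩ := hb
  choose V g hxV hV hinj hgen hcond using
    exists_conductor_generator b hC hC' hbk hd hd' hJtors hInv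
  let A := locallyGenerated J U₀ hxV g
  have hgA := fun x => mem_locallyGenerated (hxV := hxV) (g := g) hV x
  have hfree := isFreeGenerator_locallyGenerated (hxV := hxV) hV hinj hgen
  refine ⟨CurveSheaf.sheafHom A.sheaf (structureSheaf C), evalMorphism A, ?_,
    mono_evalMorphism hItors hI.rankOne A hxV g hgA hinj, ?_⟩
  · refine isInvertible_of_isFreeGenerator fun x => ?_
    obtain ⟨ℓ, hℓ⟩ := (hfree x).exists_dual
    exact ⟨V x, ℓ, hxV x, hℓ⟩
  · intro U t ht x hx
    obtain ⟨U', hU', hxU', htU'⟩ := ht x hx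
    suffices ∃ (W : C.Opens) (h : W ≤ U'), x ∈ W ∧ ∃ m : Γ(I, W),
        (evalMorphism A).app W m = res _ h (res _ hU' t) by
      obtain ⟨W, h, hxW, m, hm⟩ := this
      exact ⟨W, h.trans hU', hxW, m, hm.trans (res_res _ _ _ _)⟩
    refine Submodule.smul_induction_on (p := fun t => ∃ (W : C.Opens) (h : W ≤ U'), x ∈ W ∧
      ∃ m : Γ(I, W), (evalMorphism A).app W m = res _ h t) htU' (fun a ha l _ => ?_) ?_
    · exact exists_evalMorphism_eq (mem_minimalPrimes_or_eq_maximalIdeal hC.pure_dim) hG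
        hI.coherent A (hxV x) (hgA x) (hfree x) (hinj x) hxU' a
        (fun W hWU h s => hcond x W h _ (conductor_res b hWU ha) s) l
    · rintro t₁ t₂ ⟨W₁, h₁, hx₁, m₁, hm₁⟩ ⟨W₂, h₂, hx₂, m₂, hm₂⟩
      refine ⟨W₁ ⊓ W₂, inf_le_left.trans h₁, ⟨hx₁, hx₂⟩,
        res I inf_le_left m₁ + res I inf_le_right m₂, ?_⟩
      rw [map_add, app_res, app_res, hm₁, hm₂, res_res, res_res, res_add]
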